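/- Let $K$ be an algebraically closed field, and let $G$ be a finite simple graph each of whose connected components is a Dynkin diagram of type $A_n$ ($n\ge 1$), $D_n$ ($n\ge 4$), $E_6$, $E_7$ or $E_8$. For an orientation $\Gamma$ of $G$ (a quiver obtained by replacing each edge of $G$ by exactly one arrow in one of its two directions), let $\mathrm{rep}\,\Gamma$ be the category of finite-dimensional $K$-representations of $\Gamma$. A set $C$ of isomorphism classes of indecomposable objects of $\mathrm{rep}\,\Gamma$ is called Ext-free (or a partial tilting set) if $\mathrm{Ext}^1_\Gamma(M,N)=0$ for all $M,N\in C$ (including $M=N$). For an integer $k\ge 0$ let $f^+_\Gamma(k)$ denote the number of Ext-free sets of cardinality $k$. Then for every $k\ge 0$ the number $f^+_\Gamma(k)$ is finite and depends only on the underlying graph $G$, not on the choice of the orientation $\Gamma$: there is a nonnegative integer $f$ such that $f^+_\Gamma(k)=f$ for every orientation $\Gamma$ of $G$. -/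

import Mathlib

namespace DynkinQuiver

open CategoryTheory

universe u w

/-- The graph attached to a simply-laced Cartan matrix: distinct `i` and `j` are joined by an edge
exactly when the corresponding entry is nonzero. -/
def cartanGraph {n : ℕ} (C : Matrix (Fin n) (Fin n) ℤ) : SimpleGraph (Fin n) :=
  SimpleGraph.fromRel fun i j => C i j ≠ 0

/-- `G` is a Dynkin diagram of type `A_n` (`n ≥ 1`), `D_n` (`n ≥ 4`), `E_6`, `E_7` or `E_8`.
Mathlib's `CartanMatrix.A n` is the `n × n` Cartan matrix. -/
def IsConnectedDynkin {V : Type w} (G : SimpleGraph V) : Prop :=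
  (∃ n : ℕ, 1 ≤ n ∧ Nonempty (G ≃g cartanGraph (CartanMatrix.A n))) ∨
  (∃ n : ℕ, 4 ≤ n ∧ Nonempty (G ≃g cartanGraph (CartanMatrix.D n))) ∨
  Nonempty (G ≃g cartanGraph CartanMatrix.E₆) ∨
  Nonempty (G ≃g cartanGraph CartanMatrix.E₇) ∨
  Nonempty (G ≃g cartanGraph CartanMatrix.E₈)

/-- `G` is a disjoint union of simply-laced Dynkin diagrams. -/
def IsDynkin {I : Type w} (G : SimpleGraph I) : Prop :=
  ∀ c : G.ConnectedComponent, IsConnectedDynkin c.toSimpleGraph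

/-- An orientation of the graph `G`: each edge becomes exactly one arrow, in one of its two
possible directions, and there are no other arrows. -/
structure Orientation {I : Type w} (G : SimpleGraph I) where
  /-- `arrow i j` means that there is an arrow from `i` to `j`. -/
  arrow : I → I → Prop
  adj_iff : ∀ i j, G.Adj i j ↔ arrow i j ∨ arrow j i
  asymm : ∀ i j, arrow i j → ¬ arrow j i

/-- The quiver given by an orientation of a graph. -/
@[reducible]
def Orientation.toQuiver {I : Type w} {G : SimpleGraph I} (Γ : Orientation G) : Quiver.{0} I where
  Hom i j := PLift (Γ.arrow i j)

/-- The category `rep Γ` of finite-dimensional representations of the quiver `Γ` over `K`: a functor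
from the free category on `Γ` is the same as a family of spaces indexed by the vertices together
with a linear map for each arrow. -/
abbrev QuiverRep (K : Type u) [Field K] {I : Type w} {G : SimpleGraph I} (Γ : Orientation G) :=
  letI := Γ.toQuiver
  Paths I ⥤ FGModuleCat.{u} K

section

variable (K : Type u) [Field K] {I : Type w} {G : SimpleGraph I} (Γ : Orientation G)

/-- Isomorphism classes of representations. -/
abbrev RepClass := Quotient (isIsomorphicSetoid (QuiverRep K Γ))

variable {K Γ}

/-- `Ext¹(M, N) = 0` in the abelian category `rep Γ`. -/
def ExtOneVanishes (M N : QuiverRep K Γ) : Prop :=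
  haveI := HasExt.standard (QuiverRep K Γ)
  Subsingleton (Abelian.Ext M N 1)

/-- A set of isomorphism classes of indecomposable representations is Ext-free (a partial tilting
set) if `Ext¹(M, N) = 0` for all `M` and `N` (possibly equal) in it. -/
def IsExtFree (C : Set (RepClass K Γ)) : Prop :=
  (∀ M : QuiverRep K Γ, (⟦M⟧ : RepClass K Γ) ∈ C → Indecomposable M) ∧
  ∀ M N : QuiverRep K Γ, (⟦M⟧ : RepClass K Γ) ∈ C → (⟦N⟧ : RepClass K Γ) ∈ C →
    ExtOneVanishes M N

variable (K Γ)

/-- The collection of Ext-free sets of cardinality `k`. -/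
def extFreeSets (k : ℕ) : Set (Set (RepClass K Γ)) :=
  {C | IsExtFree C ∧ C.encard = k}

end

end DynkinQuiver

/-! By Gabriel's theorem an indecomposable representation of a Dynkin quiver is determined by its
dimension vector, and these vectors are exactly the positive roots: nonnegative integer vectors of
norm 2 for the Cartan form (`dimVec_mem_positiveRoots`, `nonempty_iso_of_dimVec_eq`,
`exists_indecomposable`). The Euler form of two dimension vectors is dim Hom - dim Ext¹, and between
indecomposables at most one of Hom and Ext¹ is nonzero (`finrank_hom_of_reach`). So Ext¹ vanishes
exactly when the Euler form is nonnegative, and Ext-free sets become `compatibleSets`: sets of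
positive roots on which the Euler form is pairwise nonnegative. These are finite in number because
the Cartan form is positive definite, and the field has disappeared.

It remains to compare orientations. A Dynkin graph is a forest, so any two orientations are linked
by reversing all arrows at a sink, repeatedly (`exists_heights_raiseBy`). If i is the sink, the
simple reflection at i carries one Euler form to the other and permutes the positive roots other
than the simple root at i. A compatible set without that simple root is sent to its reflection. A
set containing it is left alone: compatibility then forces all terms at i in either Euler form to
cancel, so the set is compatible for both orientations.

Gabriel's theorem itself is obtained with reflection functors. Positive definiteness guarantees that
reflecting a nonzero nonnegative vector at successive sinks eventually produces a negative entry
(`IsPosDef.reach`). An indecomposable must therefore become simple on the way, and every claim about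
it is pulled back from the simple case by induction on `Reach`. -/

open CategoryTheory

/-! ### Effaceability of Ext, and an elementary criterion for the vanishing of Ext¹. -/

namespace HomologicalComplex

variable {C : Type*} [Category* C] [Abelian C]

/-- The degree-zero term of a resolution of `M` (a quasi-isomorphism from a complex in nonpositive
degrees) maps onto `M`, compatibly with the quasi-isomorphism. -/
lemma exists_epi_of_quasiIso_single {M : C} {K : CochainComplex C ℤ}
    (π : K ⟶ (single C (ComplexShape.up ℤ) 0).obj M) [K.IsStrictlyLE 0] [QuasiIsoAt π 0] :
    ∃ (α : K.X 0 ⟶ M) (s : (single C (ComplexShape.up ℤ) 0).obj (K.X 0) ⟶ K),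
      Epi α ∧ s ≫ π = (single C (ComplexShape.up ℤ) 0).map α := by
  -- The term in degree 1 is zero, so everything in degree 0 is a cycle and maps onto the homology,
  -- which is `M`.
  let e := K.iCyclesIso 0 1 (by simp)
    ((K.isZero_of_isStrictlyLE 0 1 (by simp)).eq_of_tgt _ _)
  have := ((quasiIsoAt_iff_isIso_homologyMap π 0).1 inferInstance)
  have h : π.f 0 = (e.inv ≫ K.homologyπ 0 ≫ homologyMap π 0 ≫
      (singleObjHomologySelfIso (ComplexShape.up ℤ) 0 M).hom) ≫
      (singleObjXSelf (ComplexShape.up ℤ) 0 M).inv := by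
    have he : e.hom = K.iCycles 0 := iCyclesIso_hom ..
    rw [← cancel_epi e.hom]
    simp only [Category.assoc, Iso.hom_inv_id_assoc]
    rw [he, homologyπ_naturality_assoc, homologyπ_singleObjHomologySelfIso_hom_assoc,
      ← singleObjCyclesSelfIso_inv_iCycles, Iso.hom_inv_id_assoc, ← cyclesMap_i]
  refine ⟨e.inv ≫ K.homologyπ 0 ≫ homologyMap π 0 ≫
      (singleObjHomologySelfIso (ComplexShape.up ℤ) 0 M).hom, mkHomFromSingle (𝟙 _) (by
      rintro j hj
      obtain rfl : j = 1 := by simpa using hj.symm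
      apply (K.isZero_of_isStrictlyLE 0 1 (by simp)).eq_of_tgt), ?_, ?_⟩
  · infer_instance
  · apply HomologicalComplex.from_single_hom_ext
    rw [comp_f, mkHomFromSingle_f, h, single_map_f_self]
    simp

end HomologicalComplex

namespace CategoryTheory.Abelian.Ext

open _root_.DerivedCategory

universe w v u

variable {C : Type u} [Category.{v} C] [Abelian C]

/-- Every class in a positive `Ext` group is effaceable. -/
lemma exists_epi_comp_eq_zero [HasExt.{w} C] {M N : C} {n : ℕ} (x : Ext M N (n + 1)) :
    ∃ (P : C) (p : P ⟶ M), Epi p ∧ (mk₀ p).comp x (zero_add _) = 0 := by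
  let := HasDerivedCategory.standard C
  let sh := ((singleFunctors C).shiftIso (n + 1) (-(n + 1)) 0 (by lia)).hom.app N
  let L := (CochainComplex.singleFunctor C (-(n + 1))).obj N
  let φ : Q.obj ((HomologicalComplex.single C (ComplexShape.up ℤ) 0).obj M) ⟶ Q.obj L :=
    x.hom ≫ sh
  -- The class is a roof through a complex `K` in degrees ≤ 0 resolving `M`. The numerator `g` is
  -- zero in degree 0, because `L` sits in the negative degree `-(n + 1)`, so the epimorphism from
  -- `K.X 0` onto `M` kills the class.
  obtain ⟨K, hK, π, h, g, hφ⟩ := right_fac_of_isStrictlyLE φ 0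
  have h' := h
  rw [isIso_Q_map_iff_quasiIso] at h'
  obtain ⟨α, s, hα, hs⟩ := HomologicalComplex.exists_epi_of_quasiIso_single π
  have h₂ : s ≫ g = 0 := by
    apply HomologicalComplex.from_single_hom_ext
    apply (L.isZero_of_isStrictlyLE (-(n + 1)) 0 (by lia)).eq_of_tgt
  have h₃ : (singleFunctor C 0).map α ≫ φ = 0 := by
    change Q.map ((HomologicalComplex.single C (ComplexShape.up ℤ) 0).map α) ≫ φ = 0
    rw [hφ, ← hs, Q.map_comp, Category.assoc, IsIso.hom_inv_id_assoc, ← Q.map_comp, h₂,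
      Q.map_zero]
  refine ⟨_, α, hα, ?_⟩
  apply Ext.ext
  rw [comp_hom, mk₀_hom, ShiftedHom.mk₀_comp, zero_hom, ← cancel_mono sh, Limits.zero_comp,
    Category.assoc]
  exact h₃

/-- `Ext¹(M, N)` vanishes if and only if every morphism to `N` from the kernel of an epimorphism
onto `M` extends. -/
lemma subsingleton_one_iff [HasExt.{w} C] (M N : C) :
    Subsingleton (Ext M N 1) ↔ ∀ (A P : C) (f : A ⟶ P) (p : P ⟶ M) (w : f ≫ p = 0),
      (ShortComplex.mk f p w).ShortExact → ∀ φ : A ⟶ N, ∃ ψ : P ⟶ N, f ≫ ψ = φ := by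
  constructor
  · intro h A P f p w hS φ
    obtain ⟨x, hx⟩ := contravariant_sequence_exact₁ hS _ (mk₀ φ) (add_zero 1)
      (Subsingleton.elim _ _)
    obtain ⟨ψ, rfl⟩ := (mk₀_bijective P N).2 x
    refine ⟨ψ, (mk₀_bijective A N).1 ?_⟩
    rw [← hx, mk₀_comp_mk₀]
  · intro h
    refine subsingleton_of_forall_eq 0 fun x ↦ ?_
    -- Once pulled back to zero on `P`, the class is the image under the connecting map of some
    -- morphism from the kernel of `p`. If that morphism extends to `P`, its image is zero.
    obtain ⟨P, p, hp, hx⟩ := exists_epi_comp_eq_zero x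
    have hS : (ShortComplex.mk (Limits.kernel.ι p) p (Limits.kernel.condition p)).ShortExact :=
      { exact := ShortComplex.exact_kernel p }
    obtain ⟨y, rfl⟩ := contravariant_sequence_exact₃ hS N x hx (add_zero 1)
    obtain ⟨φ, rfl⟩ := (mk₀_bijective _ N).2 y
    obtain ⟨ψ, rfl⟩ := h _ _ _ _ _ hS φ
    rw [← mk₀_comp_mk₀]
    exact hS.extClass_comp_assoc _

end CategoryTheory.Abelian.Ext

/-! ### Representations as spaces and arrow maps; Ext¹ through cocycles on arrows. -/

namespace DynkinQuiver

open CategoryTheory Module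

universe u w

variable {K : Type u} [Field K] {I : Type w} {G : SimpleGraph I} {Γ : Orientation G}

namespace QuiverRep

/-- The vector space of a representation at a vertex. -/
abbrev space (M : QuiverRep K Γ) (i : I) : Type u :=
  letI := Γ.toQuiver
  FGModuleCat.carrier (M.obj i)

/-- The linear map of a representation along an arrow. -/
def arrowMap (M : QuiverRep K Γ) {i j : I} (a : Γ.arrow i j) : M.space i →ₗ[K] M.space j :=
  letI := Γ.toQuiver
  (M.map (Quiver.Hom.toPath (PLift.up a : i ⟶ j))).hom.hom

/-- The component of a morphism at a vertex. -/
def component {M N : QuiverRep K Γ} (f : M ⟶ N) (i : I) : M.space i →ₗ[K] N.space i :=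
  letI := Γ.toQuiver
  (f.app i).hom.hom

lemma component_arrowMap {M N : QuiverRep K Γ} (f : M ⟶ N) {i j : I} (a : Γ.arrow i j)
    (x : M.space i) : component f j (M.arrowMap a x) = N.arrowMap a (component f i x) := by
  let := Γ.toQuiver
  have := f.naturality (Quiver.Hom.toPath (PLift.up a : i ⟶ j))
  exact LinearMap.congr_fun congr($(this).hom.hom) x

lemma hom_ext {M N : QuiverRep K Γ} {f g : M ⟶ N}
    (h : ∀ i x, component f i x = component g i x) : f = g := by
  let := Γ.toQuiver
  apply NatTrans.ext
  funext i
  apply FGModuleCat.hom_ext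
  exact LinearMap.ext (h i)

lemma component_id (M : QuiverRep K Γ) (i : I) (x : M.space i) : component (𝟙 M) i x = x := rfl

lemma component_comp {M N P : QuiverRep K Γ} (f : M ⟶ N) (g : N ⟶ P) (i : I) (x : M.space i) :
    component (f ≫ g) i x = component g i (component f i x) := rfl

lemma component_add {M N : QuiverRep K Γ} (f g : M ⟶ N) (i : I) (x : M.space i) :
    component (f + g) i x = component f i x + component g i x := rfl

lemma component_smul {M N : QuiverRep K Γ} (c : K) (f : M ⟶ N) (i : I) (x : M.space i) :
    component (c • f) i x = c • component f i x := rfl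

lemma component_zero {M N : QuiverRep K Γ} (i : I) (x : M.space i) :
    component (0 : M ⟶ N) i x = 0 := rfl

/-- A morphism of representations from a compatible family of linear maps. -/
lemma exists_hom {M N : QuiverRep K Γ} (f : ∀ i, M.space i →ₗ[K] N.space i)
    (hf : ∀ {i j} (a : Γ.arrow i j) x, f j (M.arrowMap a x) = N.arrowMap a (f i x)) :
    ∃ g : M ⟶ N, ∀ i x, component g i x = f i x := by
  let := Γ.toQuiver
  refine ⟨Paths.liftNatTrans (fun i ↦ FGModuleCat.ofHom (f i)) ?_, fun i x ↦ rfl⟩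
  intro i j a
  apply FGModuleCat.hom_ext
  exact LinearMap.ext (hf a.down)

/-- A representation with prescribed spaces and maps. -/
lemma exists_rep (Γ : Orientation G) (V : I → FGModuleCat.{u} K)
    (φ : ∀ {i j}, Γ.arrow i j → V i →ₗ[K] V j) :
    ∃ (M : QuiverRep K Γ) (e : ∀ i, M.space i ≃ₗ[K] V i),
      ∀ {i j} (a : Γ.arrow i j) x, e j (M.arrowMap a x) = φ a (e i x) := by
  let := Γ.toQuiver
  refine ⟨Paths.lift ⟨V, fun a ↦ FGModuleCat.ofHom (φ a.down)⟩, fun i ↦ LinearEquiv.refl K _, ?_⟩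
  intro i j a x
  rfl

instance (M : QuiverRep K Γ) (i : I) : Module.Finite K (M.space i) :=
  letI := Γ.toQuiver
  inferInstanceAs (Module.Finite K (FGModuleCat.carrier (M.obj i)))

/-- Evaluation at a vertex. -/
noncomputable def evalAt (K : Type u) [Field K] (Γ : Orientation G) (i : I) :
    QuiverRep K Γ ⥤ ModuleCat.{u} K :=
  letI := Γ.toQuiver
  (evaluation (Paths I) (FGModuleCat.{u} K)).obj i ⋙ forget₂ (FGModuleCat.{u} K) (ModuleCat.{u} K)

instance (i : I) : Limits.PreservesFiniteLimits (evalAt K Γ i) :=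
  letI := Γ.toQuiver
  haveI : Limits.PreservesFiniteLimits ((evaluation (Paths I) (FGModuleCat.{u} K)).obj i) :=
    ⟨fun _ _ _ ↦ Limits.evaluation_preservesLimitsOfShape (K := Paths I) i⟩
  Limits.comp_preservesFiniteLimits ((evaluation (Paths I) (FGModuleCat.{u} K)).obj i)
    (forget₂ (FGModuleCat.{u} K) (ModuleCat.{u} K))

instance (i : I) : Limits.PreservesFiniteColimits (evalAt K Γ i) :=
  letI := Γ.toQuiver
  haveI : Limits.PreservesFiniteColimits ((evaluation (Paths I) (FGModuleCat.{u} K)).obj i) :=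
    ⟨fun _ _ _ ↦ Limits.evaluation_preservesColimitsOfShape (K := Paths I) i⟩
  Limits.comp_preservesFiniteColimits ((evaluation (Paths I) (FGModuleCat.{u} K)).obj i)
    (forget₂ (FGModuleCat.{u} K) (ModuleCat.{u} K))

instance (i : I) : (evalAt K Γ i).Additive := Functor.additive_of_preserves_binary_products _

section ShortExact

variable {A P M : QuiverRep K Γ} {f : A ⟶ P} {p : P ⟶ M} {w : f ≫ p = 0}

lemma component_injective_of_shortExact (h : (ShortComplex.mk f p w).ShortExact) (i : I) :
    Function.Injective (component f i) :=
  (h.map_of_exact (evalAt K Γ i)).moduleCat_injective_f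

lemma component_surjective_of_shortExact (h : (ShortComplex.mk f p w).ShortExact) (i : I) :
    Function.Surjective (component p i) :=
  (h.map_of_exact (evalAt K Γ i)).moduleCat_surjective_g

lemma component_exact_of_shortExact (h : (ShortComplex.mk f p w).ShortExact) (i : I)
    (x : P.space i) (hx : component p i x = 0) : ∃ y, component f i y = x :=
  ((ShortComplex.moduleCat_exact_iff _).1 (h.map_of_exact (evalAt K Γ i)).exact) x hx

lemma shortExact_of_component (hf : ∀ i, Function.Injective (component f i))
    (hp : ∀ i, Function.Surjective (component p i))
    (h : ∀ i x, component p i x = 0 → ∃ y, component f i y = x) :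
    (ShortComplex.mk f p w).ShortExact := by
  have hm : Mono f := ⟨fun g g' hg ↦ hom_ext fun i x ↦ hf i (by
    rw [← component_comp, hg, component_comp])⟩
  have he : Epi p := ⟨fun g g' hg ↦ hom_ext fun i x ↦ by
    obtain ⟨y, rfl⟩ := hp i x
    rw [← component_comp, hg, component_comp]⟩
  refine { exact := ShortComplex.exact_of_f_is_kernel _ (Limits.KernelFork.IsLimit.ofι' _ _ ?_) }
  intro X k hk
  have h₁ : ∀ i x, ∃ y, component f i y = component k i x := fun i x ↦ h i _ (by
    rw [← component_comp, hk, component_zero])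
  have h₂ : ∃ l : X ⟶ A, l ≫ f = k := by
    let e (i : I) := LinearEquiv.ofInjective (component f i) (hf i)
    have he (i : I) (x) (hx : x ∈ LinearMap.range (component f i)) :
        component f i ((e i).symm ⟨x, hx⟩) = x :=
      congrArg Subtype.val ((e i).apply_symm_apply ⟨x, hx⟩)
    obtain ⟨l, hl⟩ := exists_hom (M := X) (N := A) (fun i ↦ (e i).symm.toLinearMap ∘ₗ
      (component k i).codRestrict (LinearMap.range (component f i)) (h₁ i)) (fun {i j} a x ↦ by
        apply hf j
        rw [component_arrowMap]
        dsimp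
        erw [he, he]
        rw [component_arrowMap])
    refine ⟨l, hom_ext fun i x ↦ ?_⟩
    rw [component_comp, hl]
    exact he _ _ _
  exact ⟨h₂.choose, h₂.choose_spec⟩

end ShortExact

/-- `Ext¹` vanishes if and only if every cocycle of linear maps along arrows is a coboundary. -/
lemma extOneVanishes_iff_coboundary (M N : QuiverRep K Γ) :
    ExtOneVanishes M N ↔ ∀ c : ∀ {i j}, Γ.arrow i j → M.space i →ₗ[K] N.space j,
      ∃ f : ∀ i, M.space i →ₗ[K] N.space i, ∀ {i j} (a : Γ.arrow i j) x,
        c a x = N.arrowMap a (f i x) - f j (M.arrowMap a x) := by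
  have := HasExt.standard (QuiverRep K Γ)
  refine (Abelian.Ext.subsingleton_one_iff M N).trans ⟨fun h c ↦ ?_, fun h A P f p w hS φ ↦ ?_⟩
  -- The cocycle twists the direct sum: `E` is `N × M` with `c` as the off-diagonal part of the
  -- arrow maps. A retraction of `E` onto `N`, restricted to the second factor, exhibits `c` as a
  -- coboundary.
  · obtain ⟨E, e, he⟩ := exists_rep Γ (fun i ↦ FGModuleCat.of K (N.space i × M.space i))
      (fun {i j} a ↦ LinearMap.prod
        (N.arrowMap a ∘ₗ LinearMap.fst K _ _ + c a ∘ₗ LinearMap.snd K _ _)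
        (M.arrowMap a ∘ₗ LinearMap.snd K _ _))
    obtain ⟨f, hf⟩ := exists_hom (M := N) (N := E)
      (fun i ↦ (e i).symm.toLinearMap ∘ₗ LinearMap.inl K _ _) (fun {i j} a x ↦ by
        apply (e j).injective
        rw [he]
        simp)
    obtain ⟨p, hp⟩ := exists_hom (M := E) (N := M)
      (fun i ↦ LinearMap.snd K _ _ ∘ₗ (e i).toLinearMap) (fun {i j} a x ↦ by
        simp [he])
    have w : f ≫ p = 0 := hom_ext fun i x ↦ by
      rw [component_comp, hp, hf, component_zero]
      simp
    have hS : (ShortComplex.mk f p w).ShortExact := by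
      refine shortExact_of_component (fun i x y hxy ↦ ?_) (fun i x ↦ ⟨(e i).symm (0, x), ?_⟩)
        (fun i x hx ↦ ⟨(e i x).1, ?_⟩)
      · rw [hf, hf] at hxy
        simpa using hxy
      · rw [hp]
        simp
      · rw [hp] at hx
        rw [hf]
        apply (e i).injective
        ext <;> simp_all
    obtain ⟨r, hr⟩ := h _ _ _ _ w hS (𝟙 N)
    have hr' (i : I) (x : N.space i) : component r i ((e i).symm (x, 0)) = x := by
      have := congr(component $hr i x)
      rwa [component_comp, hf, component_id] at this
    refine ⟨fun i ↦ component r i ∘ₗ (e i).symm.toLinearMap ∘ₗ LinearMap.inr K _ _,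
      fun {i j} a x ↦ ?_⟩
    have h₁ := component_arrowMap r a ((e i).symm (0, x))
    have h₂ : E.arrowMap a ((e i).symm (0, x)) =
        (e j).symm (c a x, 0) + (e j).symm (0, M.arrowMap a x) := by
      apply (e j).injective
      rw [he]
      simp
    rw [h₂, map_add, hr'] at h₁
    simp [← h₁]
  · have hs (i : I) : ∃ s : M.space i →ₗ[K] P.space i, ∀ x, component p i (s x) = x := by
      obtain ⟨s, hs⟩ := (component p i).exists_rightInverse_of_surjective
        (LinearMap.range_eq_top.2 (component_surjective_of_shortExact hS i))
      exact ⟨s, LinearMap.congr_fun hs⟩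
    have hr (i : I) : ∃ r : P.space i →ₗ[K] A.space i, ∀ x, r (component f i x) = x := by
      obtain ⟨r, hr⟩ := (component f i).exists_leftInverse_of_injective
        (LinearMap.ker_eq_bot.2 (component_injective_of_shortExact hS i))
      exact ⟨r, LinearMap.congr_fun hr⟩
    choose s hs using hs
    choose r hr using hr
    have hf' (i : I) (x : P.space i) (hx : component p i x = 0) : component f i (r i x) = x := by
      obtain ⟨y, rfl⟩ := component_exact_of_shortExact hS i x hx
      rw [hr]
    have hpf (i : I) (x : A.space i) : component p i (component f i x) = 0 := by
      rw [← component_comp, w, component_zero]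
    let π (i : I) : P.space i →ₗ[K] A.space i := r i ∘ₗ (LinearMap.id - s i ∘ₗ component p i)
    have hπ (i : I) (x : P.space i) : component f i (π i x) = x - s i (component p i x) :=
      hf' i _ (by simp [hs])
    -- The vertexwise sections `s` fail to commute with the arrows by a cocycle with values in `A`.
    -- Pushed forward along `φ` it is a coboundary of some `g`, and adding `g` on the `M`-part makes
    -- the naive extension `φ ∘ π` a morphism.
    obtain ⟨g, hg⟩ := h (fun {i j} a ↦ component φ j ∘ₗ r j ∘ₗ
      (P.arrowMap a ∘ₗ s i - s j ∘ₗ M.arrowMap a))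
    obtain ⟨ψ, hψ⟩ := exists_hom (M := P) (N := N)
      (fun i ↦ component φ i ∘ₗ π i + g i ∘ₗ component p i) (fun {i j} a x ↦ by
        have h₁ := hg a (component p i x)
        have h₂ : π j (P.arrowMap a x) = A.arrowMap a (π i x) +
            r j (P.arrowMap a (s i (component p i x)) - s j (M.arrowMap a (component p i x))) := by
          apply component_injective_of_shortExact hS j
          rw [map_add, hπ, component_arrowMap, component_arrowMap, hπ, hf']
          · simp
          · simp [component_arrowMap, hs]
        simp only [LinearMap.add_apply, LinearMap.comp_apply, LinearMap.sub_apply] at h₁ ⊢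
        rw [h₂, map_add, h₁, component_arrowMap, component_arrowMap, map_add]
        abel)
    refine ⟨ψ, hom_ext fun i x ↦ ?_⟩
    rw [component_comp, hψ]
    have : π i (component f i x) = x := by
      apply component_injective_of_shortExact hS i
      rw [hπ, hpf, map_zero, sub_zero]
    simp [hpf, this]

end QuiverRep

end DynkinQuiver

/-! ### Indecomposability through idempotents; dimension vectors and the Euler form. -/

open CategoryTheory Module

/-- An object of an abelian category is indecomposable if and only if it is nonzero and its only
idempotent endomorphisms are `0` and `1`. -/
lemma CategoryTheory.indecomposable_iff_idempotent {C : Type*} [Category* C] [Abelian C] (X : C) :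
    Indecomposable X ↔ ¬ Limits.IsZero X ∧ ∀ e : X ⟶ X, e ≫ e = e → e = 0 ∨ e = 𝟙 X := by
  refine and_congr_right fun hX ↦ ⟨fun h e he ↦ ?_, fun h Y Z φ ↦ ?_⟩
  -- Both `e` and `𝟙 X - e` split in an abelian category, and their images decompose `X` as a
  -- biproduct.
  · obtain ⟨Y, i, p, hip, hpi⟩ := IsIdempotentComplete.idempotents_split X e he
    obtain ⟨Z, j, q, hjq, hqj⟩ := IsIdempotentComplete.idempotents_split X (𝟙 X - e) (by
      simp [he])
    have hiq : i ≫ q = 0 := by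
      have : i ≫ q ≫ j ≫ q = i ≫ q := by rw [hjq, Category.comp_id]
      rw [← this, reassoc_of% hqj, Preadditive.sub_comp, Preadditive.comp_sub, ← hpi,
        Category.assoc, reassoc_of% hip, Category.id_comp, sub_self]
    have hjp : j ≫ p = 0 := by
      have : j ≫ p ≫ i ≫ p = j ≫ p := by rw [hip, Category.comp_id]
      have h₂ : j ≫ e = 0 := by
        have h₃ : j ≫ (𝟙 X - e) = j := by rw [← hqj, reassoc_of% hjq]
        simpa using h₃
      rw [← this, reassoc_of% hpi, reassoc_of% h₂, Limits.zero_comp]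
    let φ : X ≅ Y ⊞ Z :=
      { hom := Limits.biprod.lift p q
        inv := Limits.biprod.desc i j
        hom_inv_id := by simp [hpi, hqj]
        inv_hom_id := by
          ext <;> simp [hip, hjq, hiq, hjp] }
    rcases h Y Z φ with hY | hZ
    · left
      rw [← hpi, hY.eq_zero_of_tgt p, Limits.zero_comp]
    · right
      rw [hZ.eq_zero_of_tgt q, Limits.zero_comp] at hqj
      exact (sub_eq_zero.1 hqj.symm).symm
  · rcases h (φ.hom ≫ Limits.biprod.fst ≫ Limits.biprod.inl ≫ φ.inv) (by simp) with h | h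
    · left
      rw [Limits.IsZero.iff_id_eq_zero]
      have := congr(Limits.biprod.inl ≫ φ.inv ≫ $h ≫ φ.hom ≫ Limits.biprod.fst)
      simpa using this
    · right
      rw [Limits.IsZero.iff_id_eq_zero]
      have := congr(Limits.biprod.inr ≫ φ.inv ≫ $h ≫ φ.hom ≫ Limits.biprod.snd)
      simpa using this.symm

namespace DynkinQuiver

universe u w

/-- The Euler form of an orientation. -/
noncomputable def eulerForm {I : Type w} [Fintype I] {G : SimpleGraph I} (Γ : Orientation G)
    (d e : I → ℤ) : ℤ :=
  open Classical in ∑ i, d i * e i - ∑ i, ∑ j, if Γ.arrow i j then d i * e j else 0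

variable {K : Type u} [Field K] {I : Type w} {G : SimpleGraph I} {Γ : Orientation G}

namespace QuiverRep

/-- The dimension vector of a representation. -/
noncomputable def dimVec (M : QuiverRep K Γ) (i : I) : ℤ := finrank K (M.space i)

lemma dimVec_nonneg (M : QuiverRep K Γ) : 0 ≤ M.dimVec := fun _ ↦ Int.natCast_nonneg _

lemma dimVec_eq_of_equiv {Γ' : Orientation G} {M : QuiverRep K Γ} {N : QuiverRep K Γ'} {i : I}
    (e : M.space i ≃ₗ[K] N.space i) : M.dimVec i = N.dimVec i :=
  congrArg _ e.finrank_eq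

/-- The linear equivalence of spaces at a vertex induced by an isomorphism. -/
def componentEquiv {M N : QuiverRep K Γ} (e : M ≅ N) (i : I) : M.space i ≃ₗ[K] N.space i :=
  LinearEquiv.ofLinearMap (component e.hom i) (component e.inv i)
    (LinearMap.ext fun x ↦ by
      rw [LinearMap.comp_apply, ← component_comp, e.inv_hom_id, component_id]; rfl)
    (LinearMap.ext fun x ↦ by
      rw [LinearMap.comp_apply, ← component_comp, e.hom_inv_id, component_id]; rfl)

lemma dimVec_eq_of_iso {M N : QuiverRep K Γ} (e : M ≅ N) : M.dimVec = N.dimVec :=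
  funext fun i ↦ dimVec_eq_of_equiv (componentEquiv e i)

lemma isZero_iff (M : QuiverRep K Γ) : Limits.IsZero M ↔ M.dimVec = 0 := by
  rw [Limits.IsZero.iff_id_eq_zero]
  constructor
  · intro h
    funext i
    have : Subsingleton (M.space i) := subsingleton_of_forall_eq 0 fun x ↦ by
      rw [← component_id M i x, h, component_zero]
    exact congrArg Nat.cast (finrank_zero_of_subsingleton (R := K) (M := M.space i))
  · intro h
    refine hom_ext fun i x ↦ ?_
    have : finrank K (M.space i) = 0 := Int.ofNat_inj.1 (congrFun h i)
    have := finrank_zero_iff.1 this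
    exact Subsingleton.elim _ _

/-- The components of a morphism, as a linear map. -/
def components (M N : QuiverRep K Γ) : (M ⟶ N) →ₗ[K] ∀ i, M.space i →ₗ[K] N.space i where
  toFun := component
  map_add' _ _ := rfl
  map_smul' _ _ := rfl

lemma components_injective (M N : QuiverRep K Γ) : Function.Injective (components M N) :=
  fun _ _ h ↦ hom_ext fun i x ↦ LinearMap.congr_fun (congrFun h i) x

instance [Finite I] (M N : QuiverRep K Γ) : Module.Finite K (M ⟶ N) :=
  Module.Finite.of_injective _ (components_injective M N)

/-- The differential sending a family of linear maps at the vertices to the induced family of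
linear maps along the arrows. -/
def coboundary (M N : QuiverRep K Γ) : (∀ i, M.space i →ₗ[K] N.space i) →ₗ[K]
    ∀ a : {a : I × I // Γ.arrow a.1 a.2}, M.space a.1.1 →ₗ[K] N.space a.1.2 where
  toFun f a := N.arrowMap a.2 ∘ₗ f a.1.1 - f a.1.2 ∘ₗ M.arrowMap a.2
  map_add' f g := by
    funext a
    ext x
    simp only [Pi.add_apply, LinearMap.sub_apply, LinearMap.comp_apply, LinearMap.add_apply,
      map_add]
    abel
  map_smul' c f := by
    funext a
    ext x
    simp [smul_sub]

lemma ker_coboundary (M N : QuiverRep K Γ) :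
    LinearMap.ker (coboundary M N) = LinearMap.range (components M N) := by
  ext f
  rw [LinearMap.mem_ker, LinearMap.mem_range]
  constructor
  · intro h
    obtain ⟨g, hg⟩ := exists_hom f (fun {i j} a x ↦
      (sub_eq_zero.1 (LinearMap.congr_fun (congrFun h ⟨(i, j), a⟩) x)).symm)
    exact ⟨g, funext fun i ↦ LinearMap.ext (hg i)⟩
  · rintro ⟨g, rfl⟩
    funext a
    exact LinearMap.ext fun x ↦ sub_eq_zero.2 (component_arrowMap g a.2 x).symm

lemma extOneVanishes_iff_surjective (M N : QuiverRep K Γ) :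
    ExtOneVanishes M N ↔ Function.Surjective (coboundary M N) := by
  rw [extOneVanishes_iff_coboundary]
  constructor
  · intro h c
    obtain ⟨f, hf⟩ := h (fun {i j} a ↦ c ⟨(i, j), a⟩)
    exact ⟨f, funext fun a ↦ LinearMap.ext fun x ↦ (hf a.2 x).symm⟩
  · intro h c
    obtain ⟨f, hf⟩ := h (fun a ↦ c a.2)
    exact ⟨f, fun {i j} a x ↦ (LinearMap.congr_fun (congrFun hf ⟨(i, j), a⟩) x).symm⟩

variable [Fintype I]

lemma eulerForm_dimVec (M N : QuiverRep K Γ) :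
    eulerForm Γ M.dimVec N.dimVec = (finrank K (∀ i, M.space i →ₗ[K] N.space i) : ℤ) -
      finrank K (∀ a : {a : I × I // Γ.arrow a.1 a.2}, M.space a.1.1 →ₗ[K] N.space a.1.2) := by
  classical
  rw [finrank_pi_fintype, finrank_pi_fintype, eulerForm]
  push_cast [finrank_linearMap]
  congr 1
  rw [← Fintype.sum_prod_type', ← Finset.sum_filter]
  exact Finset.sum_subtype _ (by simp) _

/-- The Euler form is bounded by the dimension of the space of morphisms, with equality precisely
when `Ext¹` vanishes. -/
lemma eulerForm_le_finrank_hom (M N : QuiverRep K Γ) :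
    eulerForm Γ M.dimVec N.dimVec ≤ finrank K (M ⟶ N) ∧
      (ExtOneVanishes M N ↔ eulerForm Γ M.dimVec N.dimVec = finrank K (M ⟶ N)) := by
  -- Rank-nullity for `coboundary`: its kernel is Hom, and it is surjective exactly when Ext¹
  -- vanishes. The Euler form is the difference of the dimensions of source and target.
  have h₁ := (coboundary M N).finrank_range_add_finrank_ker
  rw [ker_coboundary, LinearMap.finrank_range_of_inj (components_injective M N)] at h₁
  have h₂ := (LinearMap.range (coboundary M N)).finrank_le
  rw [eulerForm_dimVec, extOneVanishes_iff_surjective, ← LinearMap.range_eq_top]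
  refine ⟨by omega, fun h ↦ ?_, fun h ↦ Submodule.eq_top_of_finrank_eq (by omega)⟩
  rw [h, finrank_top] at h₁
  omega

end QuiverRep

end DynkinQuiver

/-! ### Bernstein-Gelfand-Ponomarev reflection at a sink, as a relation between representations. -/

open CategoryTheory Module

namespace DynkinQuiver

universe u w

/-- The reflection of dimension vectors at a vertex. -/
noncomputable def simpleReflection {I : Type w} [Fintype I] (G : SimpleGraph I) (i : I)
    (d : I → ℤ) : I → ℤ :=
  open Classical in Function.update d i (∑ j, (if G.Adj i j then d j else 0) - d i)

section Orientation

variable {I : Type w} {G : SimpleGraph I}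

/-- The vertex `i` is a sink. -/
def Orientation.IsSink (Γ : Orientation G) (i : I) : Prop := ∀ j, ¬ Γ.arrow i j

lemma Orientation.IsSink.arrow {Γ : Orientation G} {i : I} (h : Γ.IsSink i) {j : I}
    (a : G.Adj i j) : Γ.arrow j i :=
  ((Γ.adj_iff i j).1 a).resolve_left (h j)

/-- The orientation `Γ'` is obtained from `Γ` by reversing all arrows at the sink `i`. -/
structure IsSinkReflection (i : I) (Γ Γ' : Orientation G) : Prop where
  isSink : Γ.IsSink i
  isSource : ∀ j, ¬ Γ'.arrow j i
  arrow_iff : ∀ {j k}, j ≠ i → k ≠ i → (Γ.arrow j k ↔ Γ'.arrow j k)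

lemma IsSinkReflection.arrow {i : I} {Γ Γ' : Orientation G} (h : IsSinkReflection i Γ Γ') {j : I}
    (a : G.Adj i j) : Γ'.arrow i j :=
  ((Γ'.adj_iff i j).1 a).resolve_right (h.isSource j)

end Orientation

variable {K : Type u} [Field K] {I : Type w} [Fintype I] {G : SimpleGraph I} {Γ Γ' : Orientation G}
  {i : I}

namespace QuiverRep

open Classical in
/-- The sum of the maps of a representation along the arrows into a sink. -/
noncomputable def sumMap (M : QuiverRep K Γ) (h : Γ.IsSink i) :
    (∀ j : G.neighborSet i, M.space j) →ₗ[K] M.space i :=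
  ∑ j : G.neighborSet i, M.arrowMap (h.arrow j.2) ∘ₗ LinearMap.proj j

lemma sumMap_apply (M : QuiverRep K Γ) (h : Γ.IsSink i) (x) [Fintype (G.neighborSet i)] :
    M.sumMap h x = ∑ j : G.neighborSet i, M.arrowMap (h.arrow j.2) (x j) := by
  rw [sumMap, LinearMap.sum_apply]
  refine Finset.sum_congr (by ext; simp) fun j _ ↦ rfl

lemma sumMap_single (M : QuiverRep K Γ) (h : Γ.IsSink i) [DecidableEq (G.neighborSet i)]
    (j : G.neighborSet i) (x : M.space j) :
    M.sumMap h (Pi.single j x) = M.arrowMap (h.arrow j.2) x := by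
  classical
  rw [sumMap_apply, Finset.sum_eq_single j]
  · simp
  · intro k _ hk
    simp [hk]
  · simp

/-- The relation between a representation and its image under the reflection functor at a sink,
on representations with surjective sum map. -/
structure Reflection (h : IsSinkReflection i Γ Γ') (M : QuiverRep K Γ) (N : QuiverRep K Γ') where
  /-- The spaces away from the sink are unchanged. -/
  e : ∀ j, j ≠ i → M.space j ≃ₗ[K] N.space j
  comm : ∀ {j k} (hj : j ≠ i) (hk : k ≠ i) (a : Γ.arrow j k) (a' : Γ'.arrow j k) x,
    e k hk (M.arrowMap a x) = N.arrowMap a' (e j hj x)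
  /-- The space at the sink is replaced by the kernel of the sum map. -/
  κ : N.space i →ₗ[K] ∀ j : G.neighborSet i, M.space j
  κ_apply : ∀ y (j : G.neighborSet i), e j j.2.ne' (κ y j) = N.arrowMap (h.arrow j.2) y
  κ_injective : Function.Injective κ
  range_κ : LinearMap.range κ = LinearMap.ker (M.sumMap h.isSink)
  surjective : Function.Surjective (M.sumMap h.isSink)

lemma exists_reflection (h : IsSinkReflection i Γ Γ') (M : QuiverRep K Γ)
    (hM : Function.Surjective (M.sumMap h.isSink)) :
    ∃ N : QuiverRep K Γ', Nonempty (Reflection h M N) := by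
  have hW (j : I) : ∃ W : FGModuleCat.{u} K, (j ≠ i → Nonempty (M.space j ≃ₗ[K] W)) ∧
      (j = i → Nonempty (LinearMap.ker (M.sumMap h.isSink) ≃ₗ[K] W)) := by
    by_cases hj : j = i
    -- The kernel lies in a universe that depends on the vertex set, so a coordinate space of the
    -- same dimension stands in for it.
    · refine ⟨FGModuleCat.of K (Fin (finrank K (LinearMap.ker (M.sumMap h.isSink))) → K),
        fun h ↦ absurd hj h, fun _ ↦ ⟨LinearEquiv.ofFinrankEq _ _ (finrank_fin_fun K).symm⟩⟩
    · exact ⟨FGModuleCat.of K (M.space j), fun _ ↦ ⟨LinearEquiv.refl K _⟩, fun h ↦ absurd h hj⟩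
  choose W hW hWi using hW
  let e (j : I) (hj : j ≠ i) : M.space j ≃ₗ[K] W j := (hW j hj).some
  let ε : W i ≃ₗ[K] LinearMap.ker (M.sumMap h.isSink) := (hWi i rfl).some.symm
  let κ : W i →ₗ[K] ∀ j : G.neighborSet i, M.space j :=
    (LinearMap.ker (M.sumMap h.isSink)).subtype ∘ₗ ε.toLinearMap
  have hφ (j k : I) (a : Γ'.arrow j k) : ∃ φ : W j →ₗ[K] W k,
      (∀ (hj : j ≠ i) (hk : k ≠ i) (a' : Γ.arrow j k) x,
        φ (e j hj x) = e k hk (M.arrowMap a' x)) ∧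
      ∀ (hj : i = j) (hk : G.Adj i k) (y : W i), φ (hj ▸ y) = e k hk.ne' (κ y ⟨k, hk⟩) := by
    by_cases hj : i = j
    · subst hj
      have hk : G.Adj i k := (Γ'.adj_iff i k).2 (Or.inl a)
      exact ⟨(e k hk.ne').toLinearMap ∘ₗ
        (LinearMap.proj (⟨k, hk⟩ : G.neighborSet i) :
          (∀ j : G.neighborSet i, M.space j) →ₗ[K] M.space k) ∘ₗ κ,
        fun hj ↦ absurd rfl hj, fun _ _ _ ↦ rfl⟩
    · have hj' : j ≠ i := Ne.symm hj
      have hk : k ≠ i := fun hk ↦ h.isSource j (hk ▸ a)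
      exact ⟨(e k hk).toLinearMap ∘ₗ M.arrowMap ((h.arrow_iff hj' hk).2 a) ∘ₗ
        (e j hj').symm.toLinearMap, fun _ _ _ _ ↦ by simp, fun h ↦ absurd h hj⟩
  choose φ hφ hφi using hφ
  obtain ⟨N, E, hE⟩ := exists_rep Γ' W (fun {j k} a ↦ φ j k a)
  refine ⟨N, ⟨{
    e j hj := (e j hj).trans (E j).symm
    κ := κ ∘ₗ (E i).toLinearMap
    comm hj hk a a' x := ?_
    κ_apply y j := ?_
    κ_injective := (Subtype.val_injective.comp ε.injective).comp (E i).injective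
    range_κ := ?_
    surjective := hM }⟩⟩
  · apply (E _).injective
    rw [hE]
    simp [hφ _ _ a' hj hk a]
  · apply (E _).injective
    rw [hE]
    have := hφi _ _ (h.arrow j.2) rfl j.2 (E i y)
    simp only [LinearEquiv.trans_apply, LinearEquiv.apply_symm_apply]
    exact this.symm
  · rw [LinearMap.range_comp_of_range_eq_top _ (LinearEquiv.range _),
      LinearMap.range_comp_of_range_eq_top _ (LinearEquiv.range _), Submodule.range_subtype]

namespace Reflection

variable {h : IsSinkReflection i Γ Γ'} {M M' M'' : QuiverRep K Γ} {N N' N'' : QuiverRep K Γ'}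

/-- The sequence 0 → N_i → ⊕ M_j → M_i → 0 over the neighbors j of i is exact; surjectivity of the
sum map is what makes the dimension come out as the reflected one. -/
lemma dimVec_eq (R : Reflection h M N) : N.dimVec = simpleReflection G i M.dimVec := by
  classical
  funext j
  by_cases hj : j = i
  · subst hj
    have h₁ := (M.sumMap h.isSink).finrank_range_add_finrank_ker
    rw [LinearMap.range_eq_top.2 R.surjective, finrank_top, ← R.range_κ,
      LinearMap.finrank_range_of_inj R.κ_injective, finrank_pi_fintype] at h₁
    rw [simpleReflection, Function.update_self, ← Finset.sum_filter, Finset.sum_subtype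
      (Finset.univ.filter (G.Adj j)) (p := (· ∈ G.neighborSet j)) (by simp)]
    simp only [dimVec]
    zify at h₁
    linarith
  · rw [simpleReflection, Function.update_of_ne hj]
    exact (dimVec_eq_of_equiv (R.e j hj)).symm

/-- Two morphisms correspond to each other under reflection if they agree away from the sink. -/
def HomRel (R : Reflection h M N) (R' : Reflection h M' N') (f : M ⟶ M') (g : N ⟶ N') : Prop :=
  ∀ j hj x, component g j (R.e j hj x) = R'.e j hj (component f j x)

lemma HomRel.id (R : Reflection h M N) : HomRel R R (𝟙 M) (𝟙 N) := fun _ _ _ ↦ rfl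

lemma HomRel.zero (R : Reflection h M N) (R' : Reflection h M' N') : HomRel R R' 0 0 :=
  fun j hj x ↦ by simp [component_zero]

lemma HomRel.add {R : Reflection h M N} {R' : Reflection h M' N'} {f f' : M ⟶ M'} {g g' : N ⟶ N'}
    (H : HomRel R R' f g) (H' : HomRel R R' f' g') : HomRel R R' (f + f') (g + g') :=
  fun j hj x ↦ by rw [component_add, component_add, map_add, H, H']

lemma HomRel.smul {R : Reflection h M N} {R' : Reflection h M' N'} {f : M ⟶ M'} {g : N ⟶ N'}
    (c : K) (H : HomRel R R' f g) : HomRel R R' (c • f) (c • g) :=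
  fun j hj x ↦ by rw [component_smul, component_smul, map_smul, H]

lemma HomRel.comp {R : Reflection h M N} {R' : Reflection h M' N'} {R'' : Reflection h M'' N''}
    {f : M ⟶ M'} {g : N ⟶ N'} {f' : M' ⟶ M''} {g' : N' ⟶ N''}
    (H : HomRel R R' f g) (H' : HomRel R' R'' f' g') : HomRel R R'' (f ≫ f') (g ≫ g') :=
  fun j hj x ↦ by rw [component_comp, component_comp, H, H']

/-- At the reflected vertex the space of `N'` embeds by `κ` into the neighboring spaces, so a
morphism is determined away from `i`. -/
lemma HomRel.right_unique {R : Reflection h M N} {R' : Reflection h M' N'} {f : M ⟶ M'}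
    {g g' : N ⟶ N'} (H : HomRel R R' f g) (H' : HomRel R R' f g') : g = g' := by
  have h₁ (j : I) (hj : j ≠ i) (y : N.space j) : component g j y = component g' j y := by
    obtain ⟨x, rfl⟩ := (R.e j hj).surjective y
    rw [H, H']
  refine hom_ext fun j y ↦ ?_
  by_cases hj : j = i
  · subst hj
    apply R'.κ_injective
    funext k
    apply (R'.e k k.2.ne').injective
    rw [R'.κ_apply, R'.κ_apply, ← component_arrowMap, ← component_arrowMap, h₁ _ k.2.ne']
  · exact h₁ j hj y

/-- Dually, the space of `M` at the sink is spanned by the images of its neighbors. -/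
lemma HomRel.left_unique {R : Reflection h M N} {R' : Reflection h M' N'} {f f' : M ⟶ M'}
    {g : N ⟶ N'} (H : HomRel R R' f g) (H' : HomRel R R' f' g) : f = f' := by
  classical
  have h₁ (j : I) (hj : j ≠ i) (x : M.space j) : component f j x = component f' j x := by
    apply (R'.e j hj).injective
    rw [← H, ← H']
  refine hom_ext fun j x ↦ ?_
  by_cases hj : j = i
  · subst hj
    obtain ⟨z, rfl⟩ := R.surjective x
    rw [sumMap_apply, map_sum, map_sum]
    refine Finset.sum_congr rfl fun k _ ↦ ?_
    rw [component_arrowMap, component_arrowMap, h₁ _ k.2.ne']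
  · exact h₁ j hj x

/-- The new component at `i` is the map induced on the kernels of the sum maps, in which `κ`
identifies the reflected spaces. -/
lemma exists_homRel_right (R : Reflection h M N) (R' : Reflection h M' N') (f : M ⟶ M') :
    ∃ g : N ⟶ N', HomRel R R' f g := by
  have hφ (j : I) : ∃ φ : N.space j →ₗ[K] N'.space j,
      (∀ hj x, φ (R.e j hj x) = R'.e j hj (component f j x)) ∧
      (j = i → ∀ k (hk : k ≠ i) (a : Γ'.arrow j k) y, N'.arrowMap a (φ y) =
        R'.e k hk (component f k ((R.e k hk).symm (N.arrowMap a y)))) := by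
    by_cases hj : j = i
    · subst hj
      obtain ⟨ρ, hρ⟩ := R'.κ.exists_leftInverse_of_injective (LinearMap.ker_eq_bot.2 R'.κ_injective)
      let F : (∀ k : G.neighborSet j, M.space k) →ₗ[K] ∀ k : G.neighborSet j, M'.space k :=
        LinearMap.pi fun k ↦ component f k ∘ₗ LinearMap.proj k
      have hF (y : N.space j) : R'.κ (ρ (F (R.κ y))) = F (R.κ y) := by
        have : F (R.κ y) ∈ LinearMap.range R'.κ := by
          have hy : R.κ y ∈ LinearMap.ker (M.sumMap h.isSink) := R.range_κ ▸ ⟨y, rfl⟩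
          classical
          rw [R'.range_κ, LinearMap.mem_ker, sumMap_apply]
          rw [LinearMap.mem_ker, sumMap_apply] at hy
          have := congrArg (component f j) hy
          rw [map_sum, map_zero] at this
          rw [← this]
          exact Finset.sum_congr rfl fun k _ ↦ (component_arrowMap ..).symm
        obtain ⟨z, hz⟩ := this
        rw [← hz]
        exact congrArg _ (LinearMap.congr_fun hρ z)
      refine ⟨ρ ∘ₗ F ∘ₗ R.κ, fun hj ↦ absurd rfl hj, fun _ k hk a y ↦ ?_⟩
      have ha : G.Adj j k := (Γ'.adj_iff j k).2 (Or.inl a)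
      have h₁ := R'.κ_apply (ρ (F (R.κ y))) ⟨k, ha⟩
      rw [hF] at h₁
      refine h₁.symm.trans (congrArg (R'.e k hk) (congrArg (component f k) ?_))
      rw [LinearEquiv.eq_symm_apply]
      exact R.κ_apply y ⟨k, ha⟩
    · exact ⟨(R'.e j hj).toLinearMap ∘ₗ component f j ∘ₗ (R.e j hj).symm.toLinearMap,
        fun _ _ ↦ by simp, fun h ↦ absurd h hj⟩
  choose φ hφ hφi using hφ
  obtain ⟨g, hg⟩ := exists_hom φ (fun {j k} a y ↦ by
    have hk : k ≠ i := fun hk ↦ h.isSource j (hk ▸ a)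
    by_cases hj : j = i
    · rw [hφi j hj k hk, ← hφ k hk]
      simp
    · obtain ⟨x, rfl⟩ := (R.e j hj).surjective y
      have a' := (h.arrow_iff hj hk).2 a
      rw [← R.comm hj hk a' a, hφ, hφ, ← R'.comm hj hk a' a, component_arrowMap])
  exact ⟨g, fun j hj x ↦ by rw [hg, hφ]⟩

/-- The sum map presents the space at the sink as the cokernel of `κ`, so the component at `i` is
the induced map on cokernels. -/
lemma exists_homRel_left (R : Reflection h M N) (R' : Reflection h M' N') (g : N ⟶ N') :
    ∃ f : M ⟶ M', HomRel R R' f g := by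
  classical
  let φ' (j : I) (hj : j ≠ i) : M.space j →ₗ[K] M'.space j :=
    (R'.e j hj).symm.toLinearMap ∘ₗ component g j ∘ₗ (R.e j hj).toLinearMap
  have hφ (j : I) : ∃ φ : M.space j →ₗ[K] M'.space j,
      (∀ hj, φ = φ' j hj) ∧
      (j = i → ∀ k (hk : k ≠ i) (a : Γ.arrow k j) x, φ (M.arrowMap a x) =
        M'.arrowMap a (φ' k hk x)) := by
    by_cases hj : j = i
    · subst hj
      obtain ⟨σ, hσ⟩ := (M.sumMap h.isSink).exists_rightInverse_of_surjective
        (LinearMap.range_eq_top.2 R.surjective)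
      let F : (∀ k : G.neighborSet j, M.space k) →ₗ[K] ∀ k : G.neighborSet j, M'.space k :=
        LinearMap.pi fun k ↦ φ' k k.2.ne' ∘ₗ LinearMap.proj k
      have hF (x) : M'.sumMap h.isSink (F (σ (M.sumMap h.isSink x))) =
          M'.sumMap h.isSink (F x) := by
        have : x - σ (M.sumMap h.isSink x) ∈ LinearMap.range R.κ := by
          rw [R.range_κ, LinearMap.mem_ker, map_sub, sub_eq_zero]
          exact (LinearMap.congr_fun hσ _).symm
        obtain ⟨y, hy⟩ := this
        have h₂ : F (R.κ y) = R'.κ (component g j y) := by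
          funext k
          apply (R'.e k k.2.ne').injective
          rw [R'.κ_apply, ← component_arrowMap, ← R.κ_apply]
          exact (R'.e k k.2.ne').apply_symm_apply _
        have h₃ : M'.sumMap h.isSink (F (R.κ y)) = 0 := by
          rw [h₂, ← LinearMap.mem_ker, ← R'.range_κ]
          exact ⟨_, rfl⟩
        rw [hy, map_sub, map_sub, sub_eq_zero] at h₃
        exact h₃.symm
      refine ⟨M'.sumMap h.isSink ∘ₗ F ∘ₗ σ, fun hj ↦ absurd rfl hj, fun _ k hk a x ↦ ?_⟩
      have ha : G.Adj j k := (Γ.adj_iff j k).2 (Or.inr a)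
      have h₁ := hF (Pi.single ⟨k, ha⟩ x)
      have h₂ : F (Pi.single ⟨k, ha⟩ x) = Pi.single ⟨k, ha⟩ (φ' k hk x) := by
        funext l
        by_cases hl : l = ⟨k, ha⟩
        · subst hl
          simp [F]
        · simp [F, hl]
      rw [h₂, sumMap_single, sumMap_single] at h₁
      exact h₁
    · exact ⟨φ' j hj, fun _ ↦ rfl, fun h ↦ absurd h hj⟩
  choose φ hφ hφi using hφ
  obtain ⟨f, hf⟩ := exists_hom φ (fun {k j} a x ↦ by
    have hk : k ≠ i := fun hk ↦ h.isSink j (hk ▸ a)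
    by_cases hj : j = i
    · rw [hφi j hj k hk, hφ k hk]
    · have a' := (h.arrow_iff hk hj).1 a
      rw [hφ j hj, hφ k hk]
      apply (R'.e j hj).injective
      rw [R'.comm hk hj a a']
      simp [φ', R.comm hk hj a a', component_arrowMap])
  exact ⟨f, fun j hj x ↦ by simp [hf, hφ j hj, φ']⟩

lemma finrank_hom_eq (R : Reflection h M N) (R' : Reflection h M' N') :
    finrank K (M ⟶ M') = finrank K (N ⟶ N') := by
  choose F hF using exists_homRel_right R R'
  let L : (M ⟶ M') →ₗ[K] (N ⟶ N') :=
    { toFun := F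
      map_add' f f' := (hF _).right_unique ((hF f).add (hF f'))
      map_smul' c f := (hF _).right_unique ((hF f).smul c) }
  refine (LinearEquiv.ofBijective L ⟨fun f f' hff ↦ ?_, fun g ↦ ?_⟩).finrank_eq
  · exact (hF f).left_unique ((show F f = F f' from hff) ▸ hF f')
  · obtain ⟨f, hf⟩ := exists_homRel_left R R' g
    exact ⟨f, (hF f).right_unique hf⟩

lemma nonempty_iso (R : Reflection h M N) (R' : Reflection h M' N') (e : N ≅ N') :
    Nonempty (M ≅ M') := by
  obtain ⟨f, hf⟩ := exists_homRel_left R R' e.hom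
  obtain ⟨g, hg⟩ := exists_homRel_left R' R e.inv
  refine ⟨⟨f, g, (hf.comp hg).left_unique ?_, (hg.comp hf).left_unique ?_⟩⟩
  · rw [e.hom_inv_id]
    exact HomRel.id R
  · rw [e.inv_hom_id]
    exact HomRel.id R'

lemma indecomposable (R : Reflection h M N) (hM : Indecomposable M) : Indecomposable N := by
  rw [indecomposable_iff_idempotent] at hM ⊢
  refine ⟨fun hN ↦ hM.1 ?_, fun e he ↦ ?_⟩
  · rw [Limits.IsZero.iff_id_eq_zero] at hN ⊢
    exact (HomRel.id R).left_unique (hN ▸ HomRel.zero R R)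
  · obtain ⟨f, hf⟩ := exists_homRel_left R R e
    rcases hM.2 f ((hf.comp hf).left_unique (he.symm ▸ hf)) with rfl | rfl
    · exact Or.inl (hf.right_unique (HomRel.zero R R))
    · exact Or.inr (hf.right_unique (HomRel.id R))

end Reflection

end QuiverRep

end DynkinQuiver

/-! ### The simple representation at a sink. -/

open CategoryTheory Module

namespace DynkinQuiver

universe u w

variable {K : Type u} [Field K] {I : Type w} {G : SimpleGraph I} {Γ Γ' : Orientation G}
  {i : I}

open Classical in
lemma eulerForm_single_left [Fintype I] (h : Γ.IsSink i) (d : I → ℤ) : eulerForm Γ (Pi.single i 1) d = d i := by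
  rw [eulerForm, Finset.sum_eq_single i, Finset.sum_eq_zero]
  · simp
  · intro j _
    refine Finset.sum_eq_zero fun k _ ↦ ?_
    split_ifs with a
    · have hj : j ≠ i := fun hj ↦ h k (hj ▸ a)
      simp [hj]
    · rfl
  · intro j _ hj
    simp [hj]
  · simp

namespace QuiverRep

lemma nonempty_iso_of_bijective {M N : QuiverRep K Γ} (f : M ⟶ N)
    (hf : ∀ j, Function.Bijective (component f j)) : Nonempty (M ≅ N) := by
  let e (j : I) := LinearEquiv.ofBijective (component f j) (hf j)
  obtain ⟨g, hg⟩ := exists_hom (M := N) (N := M) (fun j ↦ (e j).symm.toLinearMap)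
    (fun {j k} a x ↦ by
      obtain ⟨y, rfl⟩ := (hf j).2 x
      rw [← component_arrowMap]
      exact ((e k).symm_apply_apply _).trans
        (congrArg (M.arrowMap a) ((e j).symm_apply_apply y).symm))
  refine ⟨⟨f, g, hom_ext fun j x ↦ ?_, hom_ext fun j x ↦ ?_⟩⟩
  · rw [component_comp, hg]
    exact (e j).symm_apply_apply x
  · rw [component_comp, hg]
    exact (e j).apply_symm_apply x

open Classical in
/-- At a sink, a linear endomorphism killing the images of all incoming arrows extends by zero. -/
lemma exists_hom_single {M : QuiverRep K Γ} (h : Γ.IsSink i) (P : M.space i →ₗ[K] M.space i)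
    (hP : ∀ {j} (a : Γ.arrow j i) x, P (M.arrowMap a x) = 0) :
    ∃ f : M ⟶ M, ∀ j x, component f j x =
      (Pi.single i P : ∀ j, M.space j →ₗ[K] M.space j) j x := by
  refine exists_hom _ fun {j k} a x ↦ ?_
  have hj : j ≠ i := fun hj ↦ h k (hj ▸ a)
  rw [Pi.single_eq_of_ne hj, LinearMap.zero_apply, map_zero]
  by_cases hk : k = i
  · subst hk
    rw [Pi.single_eq_same, hP]
  · rw [Pi.single_eq_of_ne hk, LinearMap.zero_apply]

open Classical in
/-- An indecomposable representation whose sum map at a sink is not surjective is simple. -/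
lemma dimVec_eq_single [Fintype I] {M : QuiverRep K Γ} (hM : Indecomposable M) (h : Γ.IsSink i)
    (hs : ¬ Function.Surjective (M.sumMap h)) : M.dimVec = Pi.single i 1 := by
  rw [← LinearMap.range_eq_top, Submodule.eq_top_iff'] at hs
  push Not at hs
  obtain ⟨v, hv⟩ := hs
  obtain ⟨l, hlv, hl⟩ := Submodule.exists_le_ker_of_notMem hv
  have hv₀ : v ≠ 0 := fun hv₀ ↦ hv (hv₀ ▸ Submodule.zero_mem _)
  -- Projection onto the line through `v` along `ker l`. It kills the images of all arrows, so
  -- extended by zero it is an idempotent endomorphism of `M`. It is not zero, hence it is the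
  -- identity, and `M` is that line.
  let P : M.space i →ₗ[K] M.space i := ((l v)⁻¹ • l).smulRight v
  have hPv : P v = v := by simp [P, hlv]
  obtain ⟨f, hf⟩ := exists_hom_single h P (fun {j} a x ↦ by
    have : M.arrowMap a x ∈ LinearMap.ker l := hl ⟨Pi.single
      (⟨j, (Γ.adj_iff i j).2 (Or.inr a)⟩ : G.neighborSet i) x, sumMap_single ..⟩
    rw [LinearMap.mem_ker] at this
    simp [P, this])
  have hff : f ≫ f = f := hom_ext fun j x ↦ by
    rw [component_comp]
    by_cases hj : j = i
    · subst hj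
      simp only [hf, Pi.single_eq_same]
      simp [P, hlv]
    · simp [hf, hj]
  rcases ((indecomposable_iff_idempotent M).1 hM).2 f hff with rfl | rfl
  · have := hf i v
    rw [Pi.single_eq_same, hPv, component_zero] at this
    exact absurd this.symm hv₀
  · funext j
    by_cases hj : j = i
    · subst hj
      rw [Pi.single_eq_same]
      refine congrArg Nat.cast (finrank_eq_one v hv₀ fun w ↦ ⟨(l v)⁻¹ * l w, ?_⟩)
      have := hf j w
      rw [component_id, Pi.single_eq_same] at this
      exact Eq.trans (by simp [P]) this.symm
    · have : Subsingleton (M.space j) := subsingleton_of_forall_eq 0 fun x ↦ by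
        have := hf j x
        rwa [component_id, Pi.single_eq_of_ne hj, LinearMap.zero_apply] at this
      rw [Pi.single_eq_of_ne hj]
      exact congrArg Nat.cast (finrank_zero_of_subsingleton (R := K) (M := M.space j))

section Simple

open Classical

lemma subsingleton_of_dimVec_eq_single {M : QuiverRep K Γ} (hM : M.dimVec = Pi.single i 1) {j : I}
    (hj : j ≠ i) : Subsingleton (M.space j) := by
  have : M.dimVec j = 0 := by rw [hM, Pi.single_eq_of_ne hj]
  exact finrank_zero_iff.1 (Int.ofNat_inj.1 this)

lemma finrank_of_dimVec_eq_single {M : QuiverRep K Γ} (hM : M.dimVec = Pi.single i 1) :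
    finrank K (M.space i) = 1 := by
  have : M.dimVec i = 1 := by rw [hM, Pi.single_eq_same]
  exact Int.ofNat_inj.1 this

lemma indecomposable_of_dimVec_eq_single {M : QuiverRep K Γ} (hM : M.dimVec = Pi.single i 1) :
    Indecomposable M := by
  rw [indecomposable_iff_idempotent, isZero_iff]
  refine ⟨fun h ↦ by simpa [h] using congrFun hM i, fun e he ↦ ?_⟩
  obtain ⟨v, hv, hspan⟩ := finrank_eq_one_iff'.1 (finrank_of_dimVec_eq_single hM)
  obtain ⟨c, hc⟩ := hspan (component e i v)
  have h₁ : component e i (component e i v) = component e i v := by rw [← component_comp, he]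
  rw [← hc, map_smul, ← hc, smul_smul] at h₁
  have h₂ : c * c = c := smul_left_injective K hv h₁
  have h₃ (x : M.space i) : component e i x = c • x := by
    obtain ⟨b, rfl⟩ := hspan x
    rw [map_smul, ← hc, smul_comm]
  rcases IsIdempotentElem.iff_eq_zero_or_one.1 h₂ with rfl | rfl
  · left
    refine hom_ext fun j x ↦ ?_
    by_cases hj : j = i
    · subst hj
      rw [h₃, zero_smul, component_zero]
    · have := subsingleton_of_dimVec_eq_single hM hj
      exact Subsingleton.elim _ _
  · right
    refine hom_ext fun j x ↦ ?_
    by_cases hj : j = i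
    · subst hj
      rw [h₃, one_smul, component_id]
    · have := subsingleton_of_dimVec_eq_single hM hj
      exact Subsingleton.elim _ _

lemma exists_dimVec_eq_single (K : Type u) [Field K] (Γ : Orientation G) (i : I) :
    ∃ M : QuiverRep K Γ, M.dimVec = Pi.single i 1 := by
  obtain ⟨M, e, -⟩ := exists_rep Γ
    (fun j ↦ FGModuleCat.of K (Fin (if j = i then 1 else 0) → K)) (fun _ ↦ 0)
  refine ⟨M, funext fun j ↦ ?_⟩
  rw [dimVec, (e j).finrank_eq]
  by_cases hj : j = i
  · subst hj
    simp
  · simp [hj]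

/-- The simple representation at a sink is projective. The Euler form bounds dim Hom from below, and
a morphism is determined by its component at `i`, which bounds it from above. -/
lemma finrank_hom_of_dimVec_eq_single [Fintype I] {M : QuiverRep K Γ} (hM : M.dimVec = Pi.single i 1)
    (h : Γ.IsSink i) (N : QuiverRep K Γ) : (finrank K (M ⟶ N) : ℤ) = N.dimVec i := by
  have h₁ := (eulerForm_le_finrank_hom M N).1
  rw [hM, eulerForm_single_left h] at h₁
  let L : (M ⟶ N) →ₗ[K] (M.space i →ₗ[K] N.space i) := LinearMap.proj i ∘ₗ components M N
  have hL : Function.Injective L := fun f g hfg ↦ hom_ext fun j x ↦ by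
    by_cases hj : j = i
    · subst hj
      exact LinearMap.congr_fun hfg x
    · have := subsingleton_of_dimVec_eq_single hM hj
      rw [Subsingleton.elim x 0, map_zero, map_zero]
  have h₂ := LinearMap.finrank_le_finrank_of_injective hL
  rw [finrank_linearMap, finrank_of_dimVec_eq_single hM, one_mul] at h₂
  exact le_antisymm (Int.ofNat_le.2 h₂) h₁

lemma nonempty_iso_of_dimVec_eq_single [Fintype I] {M N : QuiverRep K Γ} (hM : M.dimVec = Pi.single i 1)
    (hN : N.dimVec = Pi.single i 1) (h : Γ.IsSink i) : Nonempty (M ≅ N) := by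
  have h₁ := finrank_hom_of_dimVec_eq_single hM h N
  rw [hN, Pi.single_eq_same] at h₁
  have : Nontrivial (M ⟶ N) := nontrivial_of_finrank_pos (R := K) (by omega)
  obtain ⟨f, hf⟩ := exists_ne (0 : M ⟶ N)
  refine nonempty_iso_of_bijective f fun j ↦ ?_
  by_cases hj : j = i
  · subst hj
    have hMj := finrank_of_dimVec_eq_single hM
    have hNj := finrank_of_dimVec_eq_single hN
    have hinj : Function.Injective (component f j) := by
      obtain ⟨v, hv, hspan⟩ := finrank_eq_one_iff'.1 hMj
      rw [injective_iff_map_eq_zero]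
      intro x hx
      obtain ⟨c, rfl⟩ := hspan x
      rw [map_smul, smul_eq_zero] at hx
      rcases hx with rfl | hx
      · rw [zero_smul]
      · refine absurd (hom_ext fun k y ↦ ?_) hf
        by_cases hk : k = j
        · subst hk
          obtain ⟨b, rfl⟩ := hspan y
          rw [map_smul, hx, smul_zero, component_zero]
        · have := subsingleton_of_dimVec_eq_single hM hk
          rw [Subsingleton.elim y 0, map_zero, map_zero]
    exact ⟨hinj, (LinearMap.injective_iff_surjective_of_finrank_eq_finrank
      (hMj.trans hNj.symm)).1 hinj⟩
  · have := subsingleton_of_dimVec_eq_single hM hj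
    have := subsingleton_of_dimVec_eq_single hN hj
    exact ⟨fun _ _ _ ↦ Subsingleton.elim _ _, fun x ↦ ⟨0, Subsingleton.elim _ _⟩⟩

/-- The space of `M` at the sink is generated by the neighboring spaces, on which every morphism to
`N` vanishes. -/
lemma finrank_hom_to_simple [Fintype I] {M N : QuiverRep K Γ} (hN : N.dimVec = Pi.single i 1)
    (h : Γ.IsSink i) (hM : Function.Surjective (M.sumMap h)) : finrank K (M ⟶ N) = 0 := by
  have : Subsingleton (M ⟶ N) := subsingleton_of_forall_eq 0 fun f ↦ hom_ext fun j x ↦ by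
    by_cases hj : j = i
    · subst hj
      obtain ⟨z, rfl⟩ := hM x
      rw [sumMap_apply, map_sum, map_sum]
      refine Finset.sum_congr rfl fun k _ ↦ ?_
      have := subsingleton_of_dimVec_eq_single hN k.2.ne'
      rw [component_arrowMap, Subsingleton.elim (component f k (z k)) 0, map_zero, component_zero]
    · have := subsingleton_of_dimVec_eq_single hN hj
      exact Subsingleton.elim _ _
  exact finrank_zero_of_subsingleton

end Simple

end QuiverRep

end DynkinQuiver

/-! ### Simple reflections, the Euler and Cartan forms, positive definiteness. -/

namespace DynkinQuiver

universe w

variable {I : Type w} [Fintype I] {G : SimpleGraph I}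

open Classical in
/-- The sum of the values of a function over the neighbors of a vertex. -/
noncomputable def neighborSum {R : Type*} [AddCommMonoid R] (G : SimpleGraph I) (i : I)
    (d : I → R) : R := ∑ j, if G.Adj i j then d j else 0

lemma neighborSum_congr {R : Type*} [AddCommMonoid R] {i : I} {d e : I → R}
    (h : ∀ j, G.Adj i j → d j = e j) : neighborSum G i d = neighborSum G i e := by
  refine Finset.sum_congr rfl fun j _ ↦ ?_
  split_ifs with hj
  · exact h j hj
  · rfl

lemma neighborSum_nonneg {i : I} {d : I → ℤ} (h : 0 ≤ d) : 0 ≤ neighborSum G i d :=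
  Finset.sum_nonneg fun j _ ↦ by split_ifs; exacts [h j, le_rfl]

lemma simpleReflection_same (i : I) (d : I → ℤ) :
    simpleReflection G i d i = neighborSum G i d - d i := by
  simp [simpleReflection, neighborSum]

lemma simpleReflection_of_ne {i j : I} (hj : j ≠ i) (d : I → ℤ) :
    simpleReflection G i d j = d j := by
  simp [simpleReflection, hj]

lemma neighborSum_simpleReflection (i : I) (d : I → ℤ) :
    neighborSum G i (simpleReflection G i d) = neighborSum G i d :=
  neighborSum_congr fun _ hj ↦ simpleReflection_of_ne hj.ne' d

lemma simpleReflection_simpleReflection (i : I) (d : I → ℤ) :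
    simpleReflection G i (simpleReflection G i d) = d := by
  funext j
  by_cases hj : j = i
  · subst hj
    rw [simpleReflection_same, neighborSum_simpleReflection, simpleReflection_same]
    ring
  · rw [simpleReflection_of_ne hj, simpleReflection_of_ne hj]

open Classical in
lemma update_simpleReflection (i : I) (d : I → ℤ) (a : ℤ) :
    Function.update (simpleReflection G i d) i a = Function.update d i a := by
  funext j
  by_cases hj : j = i
  · subst hj
    simp
  · simp [hj, simpleReflection_of_ne]

lemma simpleReflection_sum {ι : Type*} (i : I) (s : Finset ι) (f : ι → I → ℤ) :
    simpleReflection G i (∑ n ∈ s, f n) = ∑ n ∈ s, simpleReflection G i (f n) := by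
  classical
  funext j
  rw [Finset.sum_apply]
  by_cases hj : j = i
  · subst hj
    simp only [simpleReflection_same, Finset.sum_sub_distrib, Finset.sum_apply, neighborSum]
    rw [Finset.sum_comm]
    congr 1
    refine Finset.sum_congr rfl fun k _ ↦ ?_
    split_ifs <;> simp
  · simp [simpleReflection_of_ne hj]

section Forms

open Classical in
/-- The bilinear form `∑ d i * e j` over all related pairs. -/
noncomputable def relForm {R : Type*} [CommRing R] (r : I → I → Prop) (d e : I → R) : R :=
  ∑ i, ∑ j, if r i j then d i * e j else 0

-- Isolates the row and column of `i`. A reflection at `i` changes nothing else, so the identities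
-- for the forms below reduce to algebra in these terms.
open Classical in
lemma relForm_eq_update {R : Type*} [CommRing R] (r : I → I → Prop) {i : I} (hi : ¬ r i i)
    (d e : I → R) : relForm r d e =
      relForm r (Function.update d i 0) (Function.update e i 0) +
        d i * (∑ j, if r i j then e j else 0) + (∑ j, if r j i then d j else 0) * e i := by
  have h₁ (j : I) (f : I → R) : ∑ k, (if r j k then d j * f k else 0) =
      d j * ∑ k, if r j k then f k else 0 := by
    rw [Finset.mul_sum]
    exact Finset.sum_congr rfl fun k _ ↦ by split_ifs <;> simp
  have h₂ (j : I) : (∑ k, if r j k then e k else 0) =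
      (∑ k, if r j k then Function.update e i 0 k else 0) + if r j i then e i else 0 := by
    rw [Fintype.sum_eq_add_sum_compl i, Fintype.sum_eq_add_sum_compl i
      (fun k ↦ if r j k then Function.update e i 0 k else 0), Function.update_self, ite_self,
      zero_add, add_comm]
    congr 1
    refine Finset.sum_congr rfl fun k hk ↦ ?_
    rw [Function.update_of_ne (by simpa using hk)]
  have h₃ : relForm r (Function.update d i 0) (Function.update e i 0) =
      ∑ j ∈ {i}ᶜ, d j * ∑ k, if r j k then Function.update e i 0 k else 0 := by
    rw [relForm, Fintype.sum_eq_add_sum_compl i, Function.update_self]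
    simp only [zero_mul, ite_self, Finset.sum_const_zero, zero_add]
    refine Finset.sum_congr rfl fun j hj ↦ ?_
    rw [Function.update_of_ne (by simpa using hj), h₁]
  have h₄ : (∑ j, if r j i then d j else 0) * e i =
      ∑ j ∈ {i}ᶜ, d j * if r j i then e i else 0 := by
    rw [Fintype.sum_eq_add_sum_compl i, if_neg hi, zero_add, Finset.sum_mul]
    exact Finset.sum_congr rfl fun j _ ↦ by split_ifs <;> simp
  rw [h₃, h₄, relForm, Fintype.sum_eq_add_sum_compl i, h₁]
  rw [Finset.sum_congr rfl fun j _ ↦ (h₁ j e).trans (congrArg _ (h₂ j))]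
  simp only [mul_add, Finset.sum_add_distrib]
  ring

open Classical in
lemma sum_mul_eq_update {R : Type*} [CommRing R] (i : I) (d e : I → R) :
    ∑ j, d j * e j = ∑ j, Function.update d i 0 j * Function.update e i 0 j + d i * e i := by
  rw [Fintype.sum_eq_add_sum_compl i, Fintype.sum_eq_add_sum_compl i
    (fun j ↦ Function.update d i 0 j * Function.update e i 0 j), Function.update_self, zero_mul,
    zero_add, add_comm]
  congr 1
  refine Finset.sum_congr rfl fun j hj ↦ ?_
  rw [Function.update_of_ne (by simpa using hj), Function.update_of_ne (by simpa using hj)]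

/-- The symmetric bilinear form of a graph. -/
noncomputable def cartanForm {R : Type*} [CommRing R] (G : SimpleGraph I) (d e : I → R) : R :=
  2 * ∑ i, d i * e i - relForm G.Adj d e

lemma eulerForm_eq (Γ : Orientation G) (d e : I → ℤ) :
    eulerForm Γ d e = ∑ i, d i * e i - relForm Γ.arrow d e := rfl

open Classical in
lemma cartanForm_eq_update {R : Type*} [CommRing R] (i : I) (d e : I → R) :
    cartanForm G d e = cartanForm G (Function.update d i 0) (Function.update e i 0) +
      2 * (d i * e i) - d i * neighborSum G i e - neighborSum G i d * e i := by
  rw [cartanForm, sum_mul_eq_update i, relForm_eq_update _ (G.irrefl (v := i)), cartanForm]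
  simp only [neighborSum, G.adj_comm _ i]
  ring

lemma cartanForm_simpleReflection (i : I) (d e : I → ℤ) :
    cartanForm G (simpleReflection G i d) (simpleReflection G i e) = cartanForm G d e := by
  rw [cartanForm_eq_update i, cartanForm_eq_update i d, update_simpleReflection,
    update_simpleReflection, neighborSum_simpleReflection, neighborSum_simpleReflection,
    simpleReflection_same, simpleReflection_same]
  ring

lemma cartanForm_eq_sum {R : Type*} [CommRing R] (d e : I → R) :
    cartanForm G d e = ∑ i, d i * (2 * e i - neighborSum G i e) := by
  classical
  simp only [cartanForm, relForm, neighborSum, mul_sub, Finset.sum_sub_distrib, Finset.mul_sum]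
  congr 1
  · exact Finset.sum_congr rfl fun i _ ↦ by ring
  · exact Finset.sum_congr rfl fun i _ ↦ Finset.sum_congr rfl fun j _ ↦ by split_ifs <;> simp

open Classical in
lemma eulerForm_of_isSink {Γ : Orientation G} {i : I} (h : Γ.IsSink i) (d e : I → ℤ) :
    eulerForm Γ d e = eulerForm Γ (Function.update d i 0) (Function.update e i 0) +
      d i * e i - neighborSum G i d * e i := by
  have (j : I) : Γ.arrow j i ↔ G.Adj i j :=
    ⟨fun a ↦ (Γ.adj_iff i j).2 (Or.inr a), h.arrow⟩
  rw [eulerForm_eq, eulerForm_eq, sum_mul_eq_update i, relForm_eq_update _ (h i)]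
  simp only [this, h _, neighborSum, if_false, Finset.sum_const_zero]
  ring

open Classical in
lemma IsSinkReflection.eulerForm_eq_update {Γ Γ' : Orientation G} {i : I}
    (h : IsSinkReflection i Γ Γ') (d e : I → ℤ) :
    eulerForm Γ' d e = eulerForm Γ (Function.update d i 0) (Function.update e i 0) +
      d i * e i - d i * neighborSum G i e := by
  have h₁ (j : I) : Γ'.arrow i j ↔ G.Adj i j :=
    ⟨fun a ↦ (Γ'.adj_iff i j).2 (Or.inl a), h.arrow⟩
  have h₂ : relForm Γ'.arrow (Function.update d i 0) (Function.update e i 0) =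
      relForm Γ.arrow (Function.update d i 0) (Function.update e i 0) := by
    refine Finset.sum_congr rfl fun j _ ↦ Finset.sum_congr rfl fun k _ ↦ ?_
    by_cases hj : j = i
    · subst hj
      simp
    · by_cases hk : k = i
      · subst hk
        simp
      · rw [h.arrow_iff hj hk]
  rw [eulerForm_eq, eulerForm_eq, sum_mul_eq_update i, relForm_eq_update _ (h.isSource i), h₂]
  simp only [h₁, h.isSource, neighborSum, if_false, Finset.sum_const_zero]
  ring

/-- Write n(d) for the neighbor sum at i and d', e' for the reflected vectors. The terms at i in the
new form are d'_i (e'_i - n(e)) = -d'_i e_i = (d_i - n(d)) e_i, which are the terms at i in the old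
one. -/
lemma IsSinkReflection.eulerForm_simpleReflection {Γ Γ' : Orientation G} {i : I}
    (h : IsSinkReflection i Γ Γ') (d e : I → ℤ) :
    eulerForm Γ' (simpleReflection G i d) (simpleReflection G i e) = eulerForm Γ d e := by
  rw [h.eulerForm_eq_update, eulerForm_of_isSink h.isSink d, update_simpleReflection,
    update_simpleReflection, neighborSum_simpleReflection, simpleReflection_same,
    simpleReflection_same]
  ring

end Forms

section PositiveDefinite

/-- The symmetric bilinear form of the graph is positive definite. -/
def IsPosDef (G : SimpleGraph I) : Prop := ∀ x : I → ℝ, x ≠ 0 → 0 < cartanForm G x x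

lemma cartanForm_cast (d e : I → ℤ) :
    ((cartanForm G d e : ℤ) : ℝ) = cartanForm G (fun i ↦ (d i : ℝ)) (fun i ↦ (e i : ℝ)) := by
  simp only [cartanForm, relForm]
  push_cast
  rfl

lemma IsPosDef.cartanForm_pos (hG : IsPosDef G) {d : I → ℤ} (hd : d ≠ 0) :
    0 < cartanForm G d d := by
  rw [← Int.cast_pos (R := ℝ), cartanForm_cast]
  refine hG _ fun h ↦ hd (funext fun i ↦ ?_)
  simpa using congrFun h i

lemma cartanForm_smul_smul {R : Type*} [CommRing R] (c : R) (x : I → R) :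
    cartanForm G (c • x) (c • x) = c ^ 2 * cartanForm G x x := by
  classical
  have h (i : I) : neighborSum G i (c • x) = c * neighborSum G i x := by
    rw [neighborSum, neighborSum, Finset.mul_sum]
    exact Finset.sum_congr rfl fun j _ ↦ by split_ifs <;> simp
  rw [cartanForm_eq_sum, cartanForm_eq_sum, Finset.mul_sum]
  refine Finset.sum_congr rfl fun i _ ↦ ?_
  rw [h]
  simp only [Pi.smul_apply, smul_eq_mul]
  ring

/-- By compactness of the unit sphere the form dominates a positive multiple of the squared norm, so
its level sets contain finitely many integer vectors. -/
lemma IsPosDef.finite_setOf_cartanForm_eq (hG : IsPosDef G) (N : ℤ) :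
    {d : I → ℤ | cartanForm G d d = N}.Finite := by
  classical
  have hc : Continuous fun x : I → ℝ ↦ cartanForm G x x := by
    simp only [cartanForm, relForm]
    refine Continuous.sub (by fun_prop) ?_
    refine continuous_finsetSum _ fun i _ ↦ continuous_finsetSum _ fun j _ ↦ ?_
    split_ifs <;> fun_prop
  obtain ⟨ε, hε, hle⟩ := (isCompact_sphere (0 : I → ℝ) 1).exists_forall_le' hc.continuousOn
    (a := 0) fun x hx ↦ hG x (by rintro rfl; simp at hx)
  have hbound (x : I → ℝ) : ε * ‖x‖ ^ 2 ≤ cartanForm G x x := by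
    by_cases hx : x = 0
    · subst hx
      simp [cartanForm, relForm]
    · have hx' : ‖x‖ ≠ 0 := norm_ne_zero_iff.2 hx
      have := hle (‖x‖⁻¹ • x) (by simp [norm_smul, hx'])
      rw [cartanForm_smul_smul, inv_pow, ← div_eq_inv_mul, le_div_iff₀ (by positivity)] at this
      exact this
  -- The extra 1 allows the estimate ‖x‖ ≤ ‖x‖² + 1 in place of a square root.
  obtain ⟨B, hB⟩ := exists_nat_gt ((N : ℝ) / ε + 1)
  refine (Set.finite_Icc (fun _ : I ↦ -(B : ℤ)) (fun _ ↦ (B : ℤ))).subset fun d hd ↦ ?_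
  have h₁ := hbound fun i ↦ (d i : ℝ)
  rw [← cartanForm_cast, show cartanForm G d d = N from hd, mul_comm, ← le_div_iff₀ hε] at h₁
  have h₂ (i : I) : |d i| ≤ (B : ℤ) := by
    have h₃ := norm_le_pi_norm (fun i ↦ (d i : ℝ)) i
    have h₄ : (|d i| : ℝ) ≤ B := by
      rw [Real.norm_eq_abs] at h₃
      have h₅ : ‖fun i ↦ (d i : ℝ)‖ ≤ ‖fun i ↦ (d i : ℝ)‖ ^ 2 + 1 := by
        nlinarith [sq_nonneg (‖fun i ↦ (d i : ℝ)‖ - 1), norm_nonneg fun i ↦ (d i : ℝ)]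
      linarith
    exact_mod_cast h₄
  exact ⟨fun i ↦ (abs_le.1 (h₂ i)).1, fun i ↦ (abs_le.1 (h₂ i)).2⟩

/-- A graph carrying a positive strictly superharmonic function has a positive definite form. -/
lemma isPosDef_of_superharmonic (u : I → ℝ) (hu : ∀ i, 0 < u i)
    (h : ∀ i, neighborSum G i u < 2 * u i) : IsPosDef G := by
  classical
  intro x hx
  -- Substituting x = u · (x / u) writes the form as a weighted sum of squares plus a Dirichlet
  -- energy of x / u; strict superharmonicity makes the weights positive.
  have h₁ : cartanForm G x x = ∑ i, x i ^ 2 / u i * (2 * u i - neighborSum G i u) +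
      ∑ i, ∑ j, (if G.Adj i j then u i * u j * (x i / u i - x j / u j) ^ 2 / 2 else 0) := by
    have h₂ (i j : I) : (if G.Adj i j then u i * u j * (x i / u i - x j / u j) ^ 2 / 2 else 0) =
        (if G.Adj i j then x i ^ 2 / u i * u j / 2 else 0) +
        (if G.Adj i j then x j ^ 2 / u j * u i / 2 else 0) -
        (if G.Adj i j then x i * x j else 0) := by
      have hi := (hu i).ne'
      have hj := (hu j).ne'
      split_ifs
      · field_simp
        ring
      · simp
    have h₃ : ∑ i, ∑ j, (if G.Adj i j then x j ^ 2 / u j * u i / 2 else 0) =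
        ∑ i, ∑ j, (if G.Adj i j then x i ^ 2 / u i * u j / 2 else 0) := by
      rw [Finset.sum_comm]
      simp only [G.adj_comm]
    have h₄ : ∑ i, ∑ j, (if G.Adj i j then x i ^ 2 / u i * u j / 2 else 0) =
        (∑ i, x i ^ 2 / u i * neighborSum G i u) / 2 := by
      rw [Finset.sum_div]
      refine Finset.sum_congr rfl fun i _ ↦ ?_
      rw [neighborSum, Finset.mul_sum, Finset.sum_div]
      exact Finset.sum_congr rfl fun j _ ↦ by split_ifs <;> simp
    have h₅ : ∑ i, x i ^ 2 / u i * (2 * u i) = 2 * ∑ i, x i * x i := by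
      rw [Finset.mul_sum]
      refine Finset.sum_congr rfl fun i _ ↦ ?_
      have hi := (hu i).ne'
      field_simp
    simp only [h₂, Finset.sum_add_distrib, Finset.sum_sub_distrib, mul_sub, h₃, h₄, h₅]
    rw [cartanForm, relForm]
    ring
  obtain ⟨i, hi⟩ := Function.ne_iff.1 hx
  rw [h₁]
  refine add_pos_of_pos_of_nonneg ?_ ?_
  · refine Finset.sum_pos' (fun j _ ↦ ?_) ⟨i, Finset.mem_univ _, ?_⟩
    · exact mul_nonneg (div_nonneg (sq_nonneg _) (hu j).le) (by linarith [h j])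
    · exact mul_pos (div_pos (sq_pos_of_ne_zero hi) (hu i)) (by linarith [h i])
  · refine Finset.sum_nonneg fun j _ ↦ Finset.sum_nonneg fun k _ ↦ ?_
    have := hu j
    have := hu k
    split_ifs
    · positivity
    · rfl

end PositiveDefinite

end DynkinQuiver

/-! ### Forests, height functions, and reflection of vectors until an entry is negative. -/

namespace DynkinQuiver

universe w

variable {I : Type w} {G : SimpleGraph I}

/-- Each vertex of a cycle has at least two neighbors on it, so the indicator vector of the cycle
has nonpositive norm. -/
lemma IsPosDef.isAcyclic [Fintype I] (hG : IsPosDef G) : G.IsAcyclic := by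
  classical
  intro v p hp
  let x : I → ℤ := fun i ↦ if i ∈ p.support then 1 else 0
  have hx : x ≠ 0 := fun h ↦ by simpa [x] using congrFun h v
  refine (hG.cartanForm_pos hx).not_ge ?_
  rw [cartanForm_eq_sum]
  refine Finset.sum_nonpos fun i _ ↦ ?_
  by_cases hi : i ∈ p.support
  · have h₁ : (2 : ℤ) ≤ neighborSum G i x := by
      rw [← Nat.cast_ofNat, ← hp.ncard_neighborSet_toSubgraph_eq_two hi, Set.ncard_eq_toFinset_card',
        Finset.card_eq_sum_ones, Nat.cast_sum, neighborSum,
        ← Finset.sum_filter_add_sum_filter_not Finset.univ (· ∈ p.toSubgraph.neighborSet i)]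
      have h₂ : ∑ j with j ∈ p.toSubgraph.neighborSet i, (if G.Adj i j then x j else 0) =
          ∑ j ∈ (p.toSubgraph.neighborSet i).toFinset, ((1 : ℕ) : ℤ) := by
        refine Finset.sum_congr (by ext; simp) fun j hj ↦ ?_
        have hj' : p.toSubgraph.Adj i j := by simpa using hj
        rw [if_pos hj'.adj_sub]
        have : j ∈ p.support := p.mem_verts_toSubgraph.1 hj'.snd_mem
        simp [x, this]
      rw [h₂]
      refine le_add_of_nonneg_right (Finset.sum_nonneg fun j _ ↦ ?_)
      simp only [x]
      split_ifs <;> simp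
    simp only [x, hi, if_true] at h₁ ⊢
    linarith
  · simp [x, hi]

/-- On a finite acyclic graph every antisymmetric function on edges is a gradient. -/
lemma exists_potential [Finite I] (hG : G.IsAcyclic) (c : I → I → ℤ) (hc : ∀ i j, c i j = -c j i) :
    ∃ h : I → ℤ, ∀ i j, G.Adj i j → h i - h j = c i j := by
  classical
  induction G using WellFoundedLT.induction with
  | ind G ih =>
    by_cases hE : ∃ a b, G.Adj a b
    · obtain ⟨a, b, hab⟩ := hE
      have hlt : G.deleteEdges {s(a, b)} < G := by
        refine lt_of_le_of_ne (G.deleteEdges_le _) fun h ↦ ?_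
        rw [← h] at hab
        simp at hab
      obtain ⟨h, hh⟩ := ih _ hlt (hG.anti hlt.le)
      have hb : ¬ (G.deleteEdges {s(a, b)}).Reachable a b :=
        SimpleGraph.isBridge_iff.1 (SimpleGraph.isAcyclic_iff_forall_adj_isBridge.1 hG hab)
      -- The edge is a bridge. Shifting the potential on the side of `a` corrects its difference
      -- across the edge and disturbs no other edge.
      refine ⟨fun i ↦ h i + if (G.deleteEdges {s(a, b)}).Reachable a i
        then c a b - (h a - h b) else 0, fun i j hij ↦ ?_⟩
      by_cases he : s(i, j) = s(a, b)
      · rcases Sym2.eq_iff.1 he with ⟨rfl, rfl⟩ | ⟨rfl, rfl⟩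
        · simp only [SimpleGraph.Reachable.refl, if_true, hb, if_false]
          ring
        · simp only [SimpleGraph.Reachable.refl, if_true, hb, if_false, hc i j]
          ring
      · have hij' : (G.deleteEdges {s(a, b)}).Adj i j := by
          rw [SimpleGraph.deleteEdges_adj]
          exact ⟨hij, he⟩
        have : (G.deleteEdges {s(a, b)}).Reachable a i ↔ (G.deleteEdges {s(a, b)}).Reachable a j :=
          ⟨fun H ↦ H.trans hij'.reachable, fun H ↦ H.trans hij'.symm.reachable⟩
        simp only [this, add_sub_add_right_eq_sub]
        exact hh i j hij'
    · exact ⟨0, fun i j hij ↦ absurd ⟨i, j, hij⟩ hE⟩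

/-- A height function on a graph changes by one along every edge. -/
def IsHeight (G : SimpleGraph I) (h : I → ℤ) : Prop :=
  ∀ i j, G.Adj i j → h i = h j + 1 ∨ h j = h i + 1

/-- The orientation with arrows going down. -/
def IsHeight.orientation {h : I → ℤ} (hh : IsHeight G h) : Orientation G where
  arrow i j := G.Adj i j ∧ h j < h i
  adj_iff i j := by
    constructor
    · intro a
      rcases hh i j a with H | H
      · exact Or.inl ⟨a, by omega⟩
      · exact Or.inr ⟨a.symm, by omega⟩
    · rintro (a | a)
      exacts [a.1, a.1.symm]
  asymm i j a b := by
    have := a.2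
    have := b.2
    omega

lemma Orientation.ext_arrow {Γ Γ' : Orientation G} (h : ∀ i j, Γ.arrow i j ↔ Γ'.arrow i j) :
    Γ = Γ' := by
  cases Γ
  cases Γ'
  congr
  funext i j
  exact propext (h i j)

lemma exists_height [Finite I] (hG : G.IsAcyclic) (Γ : Orientation G) :
    ∃ (h : I → ℤ) (hh : IsHeight G h), hh.orientation = Γ := by
  classical
  obtain ⟨h, hc⟩ := exists_potential hG
    (fun i j ↦ if Γ.arrow i j then 1 else if Γ.arrow j i then -1 else 0) (fun i j ↦ by
      have := Γ.asymm i j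
      by_cases h₁ : Γ.arrow i j <;> by_cases h₂ : Γ.arrow j i <;> simp_all)
  have h₁ {i j : I} (a : Γ.arrow i j) : h i = h j + 1 := by
    have := hc i j ((Γ.adj_iff i j).2 (Or.inl a))
    rw [if_pos a] at this
    linarith
  refine ⟨h, fun i j hij ↦ ((Γ.adj_iff i j).1 hij).imp h₁ h₁, Orientation.ext_arrow fun i j ↦ ?_⟩
  constructor
  · rintro ⟨a, b⟩
    refine ((Γ.adj_iff i j).1 a).resolve_right fun a' ↦ ?_
    have := h₁ a'
    omega
  · intro a
    have := h₁ a
    exact ⟨(Γ.adj_iff i j).2 (Or.inl a), by omega⟩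

/-- The vertex `i` is a strict local minimum of `h`. -/
def IsLocalMinVertex (G : SimpleGraph I) (h : I → ℤ) (i : I) : Prop := ∀ j, G.Adj i j → h i < h j

open Classical in
/-- Raise the value of a height function at a vertex by two. -/
noncomputable def raise (h : I → ℤ) (i : I) : I → ℤ := h + Pi.single i 2

lemma raise_same (h : I → ℤ) (i : I) : raise h i i = h i + 2 := by simp [raise]

lemma raise_of_ne (h : I → ℤ) {i j : I} (hj : j ≠ i) : raise h i j = h j := by simp [raise, hj]

lemma IsHeight.raised {h : I → ℤ} (hh : IsHeight G h) {i : I} (hi : IsLocalMinVertex G h i) :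
    IsHeight G (raise h i) := by
  intro j k hjk
  by_cases hj : j = i
  · subst hj
    rw [raise_same, raise_of_ne _ hjk.ne']
    have := hi k hjk
    have := hh j k hjk
    omega
  · by_cases hk : k = i
    · subst hk
      rw [raise_same, raise_of_ne _ hj]
      have := hi j hjk.symm
      have := hh j k hjk
      omega
    · rw [raise_of_ne _ hj, raise_of_ne _ hk]
      exact hh j k hjk

/-- Neighbors of a strict local minimum lie exactly one above it. Raised by two, it lies one above
them, so precisely the arrows at `i` turn round. -/
lemma IsHeight.isSinkReflection {h : I → ℤ} (hh : IsHeight G h) {i : I}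
    (hi : IsLocalMinVertex G h i) :
    IsSinkReflection i hh.orientation (hh.raised hi).orientation where
  isSink j a := (hi j a.1).not_gt a.2
  isSource j a := by
    have h₁ := hi j a.1.symm
    have h₂ := hh i j a.1.symm
    have h₃ := a.2
    rw [raise_same, raise_of_ne _ a.1.ne] at h₃
    omega
  arrow_iff {j k} hj hk := by
    simp only [IsHeight.orientation, raise_of_ne _ hj, raise_of_ne _ hk]

/-- `RaiseBy G h l h'` means that `h'` arises from `h` by successively raising the vertices in the
list `l`, each of which is a local minimum at that moment. -/
inductive RaiseBy (G : SimpleGraph I) : (I → ℤ) → List I → (I → ℤ) → Prop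
  | nil (h : I → ℤ) : RaiseBy G h [] h
  | cons {h h' : I → ℤ} {i : I} {l : List I} (hi : IsLocalMinVertex G h i)
      (H : RaiseBy G (raise h i) l h') : RaiseBy G h (i :: l) h'

lemma RaiseBy.add_const {h h' : I → ℤ} {l : List I} (H : RaiseBy G h l h') (c : ℤ) :
    RaiseBy G (fun i ↦ h i + c) l (fun i ↦ h' i + c) := by
  induction H with
  | nil h => exact RaiseBy.nil _
  | @cons h h' i l hi H ih =>
    refine RaiseBy.cons (fun j hj ↦ by have := hi j hj; omega) ?_
    convert ih using 1
    funext j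
    simp only [raise, Pi.add_apply]
    ring

lemma RaiseBy.eq_add_count [DecidableEq I] {h h' : I → ℤ} {l : List I} (H : RaiseBy G h l h')
    (j : I) : h' j = h j + 2 * l.count j := by
  induction H with
  | nil h => simp
  | @cons h h' i l hi H ih =>
    rw [ih]
    by_cases hj : j = i
    · subst hj
      rw [raise_same, List.count_cons_self]
      push_cast
      ring
    · rw [raise_of_ne _ hj, List.count_cons_of_ne (Ne.symm hj)]

lemma IsHeight.exists_raiseBy [Fintype I] {h h' : I → ℤ} (hh : IsHeight G h) (hh' : IsHeight G h')
    (hle : h ≤ h') (hev : ∀ i, Even (h' i - h i)) : ∃ l, RaiseBy G h l h' := by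
  obtain ⟨n, hn⟩ : ∃ n : ℕ, ∑ i, (h' i - h i) ≤ n := ⟨_, Int.self_le_toNat _⟩
  induction n generalizing h with
  | zero =>
    have h₁ : ∑ i, (h' i - h i) = 0 :=
      le_antisymm (by simpa using hn) (Finset.sum_nonneg fun i _ ↦ sub_nonneg.2 (hle i))
    rw [Finset.sum_eq_zero_iff_of_nonneg fun i _ ↦ sub_nonneg.2 (hle i)] at h₁
    have : h' = h := funext fun i ↦ sub_eq_zero.1 (h₁ i (Finset.mem_univ i))
    exact ⟨[], this ▸ RaiseBy.nil _⟩
  | succ n ih =>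
    by_cases heq : h = h'
    · exact ⟨[], heq ▸ RaiseBy.nil _⟩
    · obtain ⟨i₀, hi₀⟩ := Function.ne_iff.1 heq
      classical
      obtain ⟨i, hi, hmin⟩ := Finset.exists_min_image (Finset.univ.filter fun i ↦ h i ≠ h' i) h
        ⟨i₀, by simpa using hi₀⟩
      have hi' : h i ≠ h' i := by simpa using hi
      have h₂ : h i + 2 ≤ h' i := by
        have : h i ≤ h' i := hle i
        obtain ⟨m, hm⟩ := hev i
        omega
      have hlm : IsLocalMinVertex G h i := by
        intro j hj
        have h₃ := hh i j hj
        have h₄ := hh' i j hj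
        by_contra hcon
        by_cases hj' : h j = h' j
        · omega
        · have := hmin j (by simpa using hj')
          omega
      obtain ⟨l, hl⟩ := ih (hh.raised hlm) (fun j ↦ by
          by_cases hj : j = i
          · subst hj
            rwa [raise_same]
          · rw [raise_of_ne _ hj]
            exact hle j) (fun j ↦ by
          by_cases hj : j = i
          · subst hj
            rw [raise_same, ← sub_sub]
            exact (hev j).sub even_two
          · rw [raise_of_ne _ hj]
            exact hev j) (by
          have : ∑ j, raise h i j = ∑ j, h j + 2 := by
            simp [raise, Finset.sum_add_distrib]
          rw [Finset.sum_sub_distrib] at hn ⊢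
          push_cast at hn
          rw [this]
          omega)
      exact ⟨i :: l, RaiseBy.cons hlm hl⟩

/-- Any two orientations of a finite acyclic graph are given by height functions which are
connected by raising vertices. -/
lemma exists_heights_raiseBy [Fintype I] (hG : G.IsAcyclic) (Γ Γ' : Orientation G) :
    ∃ (h h' : I → ℤ) (hh : IsHeight G h) (hh' : IsHeight G h') (l : List I),
      hh.orientation = Γ ∧ hh'.orientation = Γ' ∧ RaiseBy G h l h' := by
  classical
  obtain ⟨h, hh, rfl⟩ := exists_height hG Γ
  obtain ⟨h', hh', rfl⟩ := exists_height hG Γ'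
  let N : ℤ := ∑ i, |h i - h' i|
  -- The target must lie above `h` with even differences. The parity of `h' - h` is constant along
  -- edges, so the correction by 1 is constant on components and, like the shift by `2 * N`, leaves
  -- the orientation unchanged.
  let h'' : I → ℤ := fun i ↦ h' i + (if Even (h' i - h i) then 0 else 1) + 2 * N
  have hpar {i j : I} (hij : G.Adj i j) : Even (h' i - h i) ↔ Even (h' j - h j) := by
    have h₁ := hh i j hij
    have h₂ := hh' i j hij
    rw [Int.even_iff, Int.even_iff]
    omega
  have hdiff {i j : I} (hij : G.Adj i j) : h'' i - h'' j = h' i - h' j := by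
    simp only [h'', hpar hij]
    ring
  have hh'' : IsHeight G h'' := fun i j hij ↦ by
    have := hdiff hij
    have := hh' i j hij
    omega
  obtain ⟨l, hl⟩ := hh.exists_raiseBy hh'' (fun i ↦ by
      have h₁ : |h i - h' i| ≤ N :=
        Finset.single_le_sum (f := fun i ↦ |h i - h' i|) (fun _ _ ↦ abs_nonneg _)
          (Finset.mem_univ i)
      have h₂ := le_abs_self (h i - h' i)
      have h₃ := abs_nonneg (h i - h' i)
      simp only [h'']
      split_ifs <;> omega) (fun i ↦ by
      simp only [h'']
      split_ifs with H
      · rw [Int.even_iff] at H ⊢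
        omega
      · rw [Int.even_iff] at H ⊢
        omega)
  refine ⟨h, h'', hh, hh'', l, rfl, Orientation.ext_arrow fun i j ↦ ?_, hl⟩
  refine and_congr_right fun hij ↦ ?_
  have := hdiff hij
  omega

/-- `Reach G h d` means that successive reflections of `d` at sinks, starting from the orientation
given by `h`, lead to a vector with a negative entry. -/
inductive Reach [Fintype I] (G : SimpleGraph I) : (I → ℤ) → (I → ℤ) → Prop
  | base {h d : I → ℤ} {i : I} (hi : IsLocalMinVertex G h i)
      (hd : ¬ 0 ≤ simpleReflection G i d) : Reach G h d
  | step {h d : I → ℤ} {i : I} (hi : IsLocalMinVertex G h i)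
      (hd : 0 ≤ simpleReflection G i d) (H : Reach G (raise h i) (simpleReflection G i d)) :
      Reach G h d

section Reach

variable [Fintype I]

/-- The composite of the reflections at the vertices of a list. -/
noncomputable def wordReflection (G : SimpleGraph I) : List I → (I → ℤ) → (I → ℤ)
  | [], d => d
  | i :: l, d => wordReflection G l (simpleReflection G i d)

lemma RaiseBy.not_reach {h h' : I → ℤ} {l : List I} (H : RaiseBy G h l h') {d : I → ℤ}
    (hd : 0 ≤ d) (hr : ¬ Reach G h d) :
    0 ≤ wordReflection G l d ∧ ¬ Reach G h' (wordReflection G l d) := by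
  induction H generalizing d with
  | nil h => exact ⟨hd, hr⟩
  | @cons h h' i l hi H ih =>
    have hd' : 0 ≤ simpleReflection G i d := by
      by_contra hd'
      exact hr (Reach.base hi hd')
    exact ih hd' fun hr' ↦ hr (Reach.step hi hd' hr')

lemma cartanForm_wordReflection (l : List I) (d : I → ℤ) :
    cartanForm G (wordReflection G l d) (wordReflection G l d) = cartanForm G d d := by
  induction l generalizing d with
  | nil => rfl
  | cons i l ih => rw [wordReflection, ih, cartanForm_simpleReflection]

lemma wordReflection_sum {ι : Type*} (l : List I) (s : Finset ι) (f : ι → I → ℤ) :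
    wordReflection G l (∑ n ∈ s, f n) = ∑ n ∈ s, wordReflection G l (f n) := by
  induction l generalizing f with
  | nil => rfl
  | cons i l ih => simp only [wordReflection, simpleReflection_sum, ih]

lemma wordReflection_of_notMem {l : List I} {i : I} (hi : i ∉ l) (d : I → ℤ) :
    wordReflection G l d i = d i := by
  induction l generalizing d with
  | nil => rfl
  | cons j l ih =>
    rw [List.mem_cons, not_or] at hi
    rw [wordReflection, ih hi.2, simpleReflection_of_ne hi.1]

/-- Each letter occurs once, so each coordinate is changed only by its own reflection; none can have
moved if the composite fixes `d`. -/
lemma simpleReflection_eq_of_wordReflection_eq {l : List I} (hl : l.Nodup) {d : I → ℤ}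
    (hd : wordReflection G l d = d) {i : I} (hi : i ∈ l) : simpleReflection G i d = d := by
  induction l with
  | nil => simp at hi
  | cons j l ih =>
    rw [List.nodup_cons] at hl
    have hj : simpleReflection G j d = d := by
      funext k
      by_cases hk : k = j
      · subst hk
        rw [← wordReflection_of_notMem hl.1 (simpleReflection G k d)]
        exact congrFun hd k
      · rw [simpleReflection_of_ne hk]
    rw [wordReflection, hj] at hd
    rcases List.mem_cons.1 hi with rfl | hi
    · exact hj
    · exact ih hl.2 hd hi

/-- Otherwise all iterates of a Coxeter transformation on `d` stay nonnegative. They have the same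
norm, so two of them coincide, and the sum over a period is invariant under the transformation,
hence under every simple reflection. Such a vector lies in the radical of the form and is zero; its
nonnegative summands are then zero too, contradicting the norm of `d`. -/
lemma IsPosDef.reach (hG : IsPosDef G) {h : I → ℤ} (hh : IsHeight G h) {d : I → ℤ} (hd : 0 ≤ d)
    (hd₀ : d ≠ 0) : Reach G h d := by
  classical
  by_contra hr
  -- Raising every height by two uses each vertex exactly once: `l` is a Coxeter word, and it
  -- returns to the same orientation.
  obtain ⟨l, hl⟩ := hh.exists_raiseBy (h' := fun i ↦ h i + 2) (fun i j hij ↦ by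
    have := hh i j hij
    dsimp only
    omega) (fun i ↦ by simp) (fun i ↦ by simp)
  have hcount (i : I) : l.count i = 1 := by
    have : h i + 2 = h i + 2 * l.count i := hl.eq_add_count i
    omega
  have hnodup : l.Nodup := List.nodup_iff_count_le_one.2 fun i ↦ (hcount i).le
  have hmem (i : I) : i ∈ l := List.one_le_count_iff.1 (hcount i).ge
  let f (n : ℕ) : I → ℤ := (wordReflection G l)^[n] d
  have hf (n : ℕ) : f (n + 1) = wordReflection G l (f n) := Function.iterate_succ_apply' ..
  have h₁ (n : ℕ) : 0 ≤ f n ∧ ¬ Reach G (fun i ↦ h i + 2 * n) (f n) := by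
    induction n with
    | zero => simpa [f] using ⟨hd, hr⟩
    | succ n ih =>
      rw [hf]
      have := (hl.add_const (2 * n)).not_reach ih.1 ih.2
      convert this using 4
      push_cast
      ring
  have h₂ (n : ℕ) : cartanForm G (f n) (f n) = cartanForm G d d := by
    induction n with
    | zero => rfl
    | succ n ih => rw [hf, cartanForm_wordReflection, ih]
  obtain ⟨a, -, b, -, hab, hfab⟩ := Set.infinite_univ.exists_lt_map_eq_of_mapsTo
    (f := f) (t := {x | cartanForm G x x = cartanForm G d d}) (fun n _ ↦ h₂ n)
    (hG.finite_setOf_cartanForm_eq _)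
  let v := ∑ n ∈ Finset.Ico a b, f n
  have hv : wordReflection G l v = v := by
    rw [wordReflection_sum]
    simp only [← hf]
    rw [Finset.sum_Ico_add' f a b 1]
    have e₁ := Finset.sum_Ico_succ_top (f := f) hab.le
    have e₂ := Finset.sum_eq_sum_Ico_succ_bot (f := f) (Nat.lt_succ_of_lt hab)
    rw [e₁, ← hfab, add_comm] at e₂
    exact (add_left_cancel e₂).symm
  have hv₀ : v = 0 := by
    by_contra hv₀
    refine (hG.cartanForm_pos hv₀).ne' ?_
    rw [cartanForm_eq_sum]
    refine Finset.sum_eq_zero fun i _ ↦ ?_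
    have := congrFun (simpleReflection_eq_of_wordReflection_eq hnodup hv (hmem i)) i
    rw [simpleReflection_same] at this
    rw [show 2 * v i - neighborSum G i v = 0 by linarith, mul_zero]
  have hfa : f a = 0 := by
    funext i
    have := congrFun hv₀ i
    simp only [v] at this
    rw [Finset.sum_apply, Pi.zero_apply,
      Finset.sum_eq_zero_iff_of_nonneg fun n _ ↦ (h₁ n).1 i] at this
    exact this a (Finset.left_mem_Ico.2 hab)
  refine (hG.cartanForm_pos hd₀).ne' ?_
  rw [← h₂ a, hfa]
  simp [cartanForm_eq_sum]

-- Let c < 0 be the reflected entry at `i` and n ≥ 0 the neighbor sum. The norm 2 equals 2c² - 2cn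
-- plus the norm of `d` with its entry at `i` removed. As 2c² ≥ 2, that remaining norm is not
-- positive, so the other entries vanish.
open Classical in
lemma IsPosDef.eq_single (hG : IsPosDef G) {d : I → ℤ} (hd : 0 ≤ d) (hq : cartanForm G d d = 2)
    {i : I} (hi : ¬ 0 ≤ simpleReflection G i d) : d = Pi.single i 1 := by
  have h₁ : simpleReflection G i d i < 0 := by
    by_contra h₁
    refine hi fun j ↦ ?_
    by_cases hj : j = i
    · subst hj
      exact not_lt.1 h₁
    · rw [simpleReflection_of_ne hj]
      exact hd j
  have h₂ := cartanForm_simpleReflection (G := G) i d d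
  rw [cartanForm_eq_update i, update_simpleReflection, neighborSum_simpleReflection, hq] at h₂
  have h₃ := neighborSum_nonneg (G := G) (i := i) hd
  have h₄ : Function.update d i 0 = 0 := by
    by_contra h₄
    have := hG.cartanForm_pos h₄
    nlinarith
  have h₅ : d = Pi.single i (d i) := by
    funext j
    by_cases hj : j = i
    · subst hj
      simp
    · have := congrFun h₄ j
      rw [Function.update_of_ne hj] at this
      rw [this, Pi.single_eq_of_ne hj, Pi.zero_apply]
  have h₆ : neighborSum G i d = 0 := by
    refine Finset.sum_eq_zero fun j _ ↦ ?_
    split_ifs with hj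
    · rw [h₅, Pi.single_eq_of_ne hj.ne']
    · rfl
  rw [cartanForm_eq_update i, h₄, h₆] at hq
  have h₇ : cartanForm G (0 : I → ℤ) 0 = 0 := by simp [cartanForm_eq_sum]
  have h₈ : d i = 1 := by
    have := hd i
    simp only [Pi.zero_apply] at this
    nlinarith
  rw [h₅, h₈]

end Reach

end DynkinQuiver

open CategoryTheory Module

namespace DynkinQuiver

universe u w

/-! ### Compatible sets of positive roots and their count under reflection. -/

section Combinatorics

variable {I : Type w} [Fintype I] {G : SimpleGraph I}

/-- The positive roots of a graph. -/
def positiveRoots (G : SimpleGraph I) : Set (I → ℤ) := {d | 0 ≤ d ∧ cartanForm G d d = 2}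

lemma IsPosDef.finite_positiveRoots (hG : IsPosDef G) : (positiveRoots G).Finite :=
  (hG.finite_setOf_cartanForm_eq 2).subset fun _ hd ↦ hd.2

open Classical in
lemma neighborSum_single (i : I) : neighborSum G i (Pi.single i (1 : ℤ)) = 0 := by
  refine Finset.sum_eq_zero fun j _ ↦ ?_
  split_ifs with hj
  · rw [Pi.single_eq_of_ne hj.ne']
  · rfl

open Classical in
lemma single_mem_positiveRoots (i : I) : Pi.single i 1 ∈ positiveRoots G := by
  refine ⟨fun j ↦ ?_, ?_⟩
  · by_cases hj : j = i
    · subst hj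
      simp
    · simp [hj]
  · rw [cartanForm_eq_sum, Finset.sum_eq_single i]
    · rw [neighborSum_single]
      simp
    · intro j _ hj
      simp [hj]
    · simp

open Classical in
lemma not_nonneg_simpleReflection_single (i : I) :
    ¬ 0 ≤ simpleReflection G i (Pi.single i 1) := fun h ↦ by
  have := h i
  rw [simpleReflection_same, neighborSum_single] at this
  simp at this

open Classical in
lemma IsPosDef.simpleReflection_nonneg (hG : IsPosDef G) {i : I} {d : I → ℤ}
    (hd : d ∈ positiveRoots G) (hi : d ≠ Pi.single i 1) : 0 ≤ simpleReflection G i d := by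
  by_contra h
  exact hi (hG.eq_single hd.1 hd.2 h)

open Classical in
lemma IsPosDef.simpleReflection_mem (hG : IsPosDef G) {i : I} {d : I → ℤ}
    (hd : d ∈ positiveRoots G) (hi : d ≠ Pi.single i 1) :
    simpleReflection G i d ∈ positiveRoots G :=
  ⟨hG.simpleReflection_nonneg hd hi, (cartanForm_simpleReflection i d d).trans hd.2⟩

/-- The sets of `k` positive roots on which the Euler form is nonnegative. -/
def compatibleSets (Γ : Orientation G) (k : ℕ) : Set (Set (I → ℤ)) :=
  {S | S ⊆ positiveRoots G ∧ (∀ d ∈ S, ∀ e ∈ S, 0 ≤ eulerForm Γ d e) ∧ S.encard = k}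

lemma IsPosDef.finite_compatibleSets (hG : IsPosDef G) (Γ : Orientation G) (k : ℕ) :
    (compatibleSets Γ k).Finite :=
  hG.finite_positiveRoots.finite_subsets.subset fun _ hS ↦ hS.1

variable {Γ Γ' : Orientation G} {i : I}

open Classical in
/-- On sets of positive roots containing the simple root of the reflected sink, the two Euler forms
have the same compatible sets. -/
lemma IsSinkReflection.eulerForm_nonneg_iff (h : IsSinkReflection i Γ Γ') (hG : IsPosDef G)
    {S : Set (I → ℤ)} (hS : S ⊆ positiveRoots G) (hi : Pi.single i 1 ∈ S) :
    (∀ d ∈ S, ∀ e ∈ S, 0 ≤ eulerForm Γ d e) ↔ ∀ d ∈ S, ∀ e ∈ S, 0 ≤ eulerForm Γ' d e := by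
  have hupd : Function.update (Pi.single i (1 : ℤ) : I → ℤ) i 0 = 0 := by
    funext j
    by_cases hj : j = i
    · subst hj
      simp
    · simp [hj]
  have hz₁ (d : I → ℤ) : eulerForm Γ d 0 = 0 := by simp [eulerForm]
  have hz₂ (d : I → ℤ) : eulerForm Γ 0 d = 0 := by simp [eulerForm]
  have h₁ (d : I → ℤ) : eulerForm Γ d (Pi.single i 1) = d i - neighborSum G i d := by
    rw [eulerForm_of_isSink h.isSink, hupd, hz₁]
    simp
  have h₂ (d : I → ℤ) : eulerForm Γ' (Pi.single i 1) d = d i - neighborSum G i d := by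
    rw [h.eulerForm_eq_update, hupd, hz₂]
    simp
  have h₃ (d : I → ℤ) : eulerForm Γ (Pi.single i 1) d = d i := eulerForm_single_left h.isSink d
  have h₄ (d : I → ℤ) : eulerForm Γ' d (Pi.single i 1) = d i := by
    rw [h.eulerForm_eq_update, hupd, hz₁, neighborSum_single]
    simp
  -- A root other than the simple one stays nonnegative under reflection, so its entry at `i` is at
  -- most its neighbor sum. Compatibility with the simple root gives the opposite inequality.
  have h₅ (d) (hd : d ∈ S) (hdi : d ≠ Pi.single i 1) : d i - neighborSum G i d ≤ 0 := by
    have := hG.simpleReflection_nonneg (hS hd) hdi i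
    rw [simpleReflection_same, Pi.zero_apply] at this
    linarith
  -- Under this equality the terms at `i` cancel in both Euler forms, which then agree on pairs of
  -- non-simple roots of `S`.
  have h₆ (hP : ∀ d ∈ S, d ≠ Pi.single i 1 → d i = neighborSum G i d) (d) (hd : d ∈ S) (e)
      (he : e ∈ S) : 0 ≤ eulerForm Γ d e ↔ 0 ≤ eulerForm Γ' d e := by
    have hdi : 0 ≤ d i := (hS hd).1 i
    have hei : 0 ≤ e i := (hS he).1 i
    by_cases hd' : d = Pi.single i 1
    · subst hd'
      rw [h₂, h₃]
      by_cases he' : e = Pi.single i 1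
      · subst he'
        rw [neighborSum_single, sub_zero]
      · rw [← hP e he he', sub_self]
        simpa using hei
    · by_cases he' : e = Pi.single i 1
      · subst he'
        rw [h₁, h₄, ← hP d hd hd', sub_self]
        simpa using hdi
      · rw [eulerForm_of_isSink h.isSink, h.eulerForm_eq_update, ← hP d hd hd', ← hP e he he']
  constructor
  · intro H d hd e he
    exact (h₆ (fun d hd hdi ↦ by linarith [h₁ d, H d hd _ hi, h₅ d hd hdi]) d hd e he).1
      (H d hd e he)
  · intro H d hd e he
    exact (h₆ (fun d hd hdi ↦ by linarith [h₂ d, H _ hi d hd, h₅ d hd hdi]) d hd e he).2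
      (H d hd e he)

/-- The number of compatible sets does not change under reflection at a sink. -/
lemma IsSinkReflection.encard_compatibleSets (h : IsSinkReflection i Γ Γ') (hG : IsPosDef G)
    (k : ℕ) : (compatibleSets Γ k).encard = (compatibleSets Γ' k).encard := by
  classical
  -- The same `φ` serves in both directions: it is an involution on sets of positive roots, since a
  -- reflected set of positive roots never contains the simple root at `i`.
  let φ (S : Set (I → ℤ)) : Set (I → ℤ) :=
    if Pi.single i 1 ∈ S then S else simpleReflection G i '' S
  have hinv : Function.Involutive (simpleReflection G i) := simpleReflection_simpleReflection i
  have hmem (S : Set (I → ℤ)) (hS : S ⊆ positiveRoots G) :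
      Pi.single i 1 ∉ simpleReflection G i '' S := by
    rintro ⟨d, hd, hdi⟩
    refine not_nonneg_simpleReflection_single (G := G) i ?_
    rw [← hdi, hinv]
    exact (hS hd).1
  have hφφ (S : Set (I → ℤ)) (hS : S ⊆ positiveRoots G) : φ (φ S) = S := by
    by_cases hi : Pi.single i 1 ∈ S
    · simp [φ, hi]
    · have h₁ : φ S = simpleReflection G i '' S := if_neg hi
      have h₂ : φ (simpleReflection G i '' S) = simpleReflection G i '' (simpleReflection G i '' S) :=
        if_neg (hmem S hS)
      rw [h₁, h₂, Set.image_image]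
      simp only [hinv _, Set.image_id']
  have hφsub (S : Set (I → ℤ)) (hS : S ⊆ positiveRoots G) : φ S ⊆ positiveRoots G := by
    by_cases hi : Pi.single i 1 ∈ S
    · simpa [φ, hi] using hS
    · rw [show φ S = simpleReflection G i '' S from if_neg hi]
      rintro _ ⟨d, hd, rfl⟩
      exact hG.simpleReflection_mem (hS hd) fun hdi ↦ hi (hdi ▸ hd)
  have hφcard (S : Set (I → ℤ)) : (φ S).encard = S.encard := by
    by_cases hi : Pi.single i 1 ∈ S
    · simp [φ, hi]
    · rw [show φ S = simpleReflection G i '' S from if_neg hi, hinv.injective.encard_image]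
  have hmaps : Set.MapsTo φ (compatibleSets Γ k) (compatibleSets Γ' k) := by
    rintro S ⟨hS, hE, hk⟩
    refine ⟨hφsub S hS, ?_, (hφcard S).trans hk⟩
    by_cases hi : Pi.single i 1 ∈ S
    · rw [show φ S = S from if_pos hi]
      exact (h.eulerForm_nonneg_iff hG hS hi).1 hE
    · rw [show φ S = simpleReflection G i '' S from if_neg hi]
      rintro _ ⟨d, hd, rfl⟩ _ ⟨e, he, rfl⟩
      rw [h.eulerForm_simpleReflection]
      exact hE d hd e he
  have hmaps' : Set.MapsTo φ (compatibleSets Γ' k) (compatibleSets Γ k) := by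
    rintro S ⟨hS, hE, hk⟩
    refine ⟨hφsub S hS, ?_, (hφcard S).trans hk⟩
    by_cases hi : Pi.single i 1 ∈ S
    · rw [show φ S = S from if_pos hi]
      exact (h.eulerForm_nonneg_iff hG hS hi).2 hE
    · rw [show φ S = simpleReflection G i '' S from if_neg hi]
      rintro _ ⟨d, hd, rfl⟩ _ ⟨e, he, rfl⟩
      rw [← h.eulerForm_simpleReflection, hinv, hinv]
      exact hE d hd e he
  have hbij : Set.BijOn φ (compatibleSets Γ k) (compatibleSets Γ' k) :=
    Set.InvOn.bijOn (f' := φ) ⟨fun S hS ↦ hφφ S hS.1, fun S hS ↦ hφφ S hS.1⟩ hmaps hmaps'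
  rw [← hbij.image_eq, hbij.injOn.encard_image]

lemma RaiseBy.encard_compatibleSets (hG : IsPosDef G) (k : ℕ) {h h' : I → ℤ} {l : List I}
    (H : RaiseBy G h l h') (hh : IsHeight G h) (hh' : IsHeight G h') :
    (compatibleSets hh.orientation k).encard = (compatibleSets hh'.orientation k).encard := by
  induction H with
  | nil h => rfl
  | @cons h h' i l hi H ih =>
    exact ((hh.isSinkReflection hi).encard_compatibleSets hG k).trans (ih (hh.raised hi) hh')

lemma IsPosDef.encard_compatibleSets (hG : IsPosDef G) (Γ Γ' : Orientation G) (k : ℕ) :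
    (compatibleSets Γ k).encard = (compatibleSets Γ' k).encard := by
  obtain ⟨h, h', hh, hh', l, rfl, rfl, H⟩ := exists_heights_raiseBy hG.isAcyclic Γ Γ'
  exact H.encard_compatibleSets hG k hh hh'

end Combinatorics

/-! ### Gabriel's theorem by induction on `Reach`, and the translation of Ext-free sets. -/

variable {K : Type u} [Field K] {I : Type w} [Fintype I] {G : SimpleGraph I} {Γ : Orientation G}

namespace QuiverRep

open Classical in
/-- At a sink, an indecomposable representation is simple or can be reflected. -/
lemma dimVec_eq_single_or_exists_reflection {h : I → ℤ} (hh : IsHeight G h) {i : I}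
    (hi : IsLocalMinVertex G h i) (M : QuiverRep K hh.orientation) (hM : Indecomposable M) :
    M.dimVec = Pi.single i 1 ∨ ∃ N : QuiverRep K (hh.raised hi).orientation,
      Nonempty (Reflection (hh.isSinkReflection hi) M N) := by
  by_cases hs : Function.Surjective (M.sumMap (hh.isSinkReflection hi).isSink)
  · exact Or.inr (exists_reflection _ M hs)
  · exact Or.inl (dimVec_eq_single hM _ hs)

open Classical in
lemma dimVec_eq_single_of_not_nonneg {h : I → ℤ} (hh : IsHeight G h) {i : I}
    (hi : IsLocalMinVertex G h i) (M : QuiverRep K hh.orientation) (hM : Indecomposable M)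
    (hd : ¬ 0 ≤ simpleReflection G i M.dimVec) : M.dimVec = Pi.single i 1 := by
  refine (dimVec_eq_single_or_exists_reflection hh hi M hM).resolve_right ?_
  rintro ⟨N, ⟨R⟩⟩
  exact hd (R.dimVec_eq ▸ N.dimVec_nonneg)

/-- Reflection preserves norm and indecomposability, and a representation whose vector would turn
negative cannot be reflected, so it is simple. The next two lemmas follow the same induction. -/
lemma cartanForm_dimVec_of_reach {h d : I → ℤ} (H : Reach G h d) (hh : IsHeight G h)
    (M : QuiverRep K hh.orientation) (hM : Indecomposable M) (hd : M.dimVec = d) :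
    cartanForm G d d = 2 := by
  induction H with
  | base hi hd' =>
    subst hd
    rw [dimVec_eq_single_of_not_nonneg hh hi M hM hd']
    exact (single_mem_positiveRoots _).2
  | step hi hd' H ih =>
    subst hd
    rcases dimVec_eq_single_or_exists_reflection hh hi M hM with h₁ | ⟨N, ⟨R⟩⟩
    · rw [h₁]
      exact (single_mem_positiveRoots _).2
    · rw [← cartanForm_simpleReflection]
      exact ih (hh.raised hi) N (R.indecomposable hM) R.dimVec_eq

lemma nonempty_iso_of_reach {h d : I → ℤ} (H : Reach G h d) (hh : IsHeight G h)
    (M N : QuiverRep K hh.orientation) (hM : Indecomposable M) (hN : Indecomposable N)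
    (hMd : M.dimVec = d) (hNd : N.dimVec = d) : Nonempty (M ≅ N) := by
  induction H with
  | base hi hd' =>
    subst hMd
    have h₁ := dimVec_eq_single_of_not_nonneg hh hi M hM hd'
    exact nonempty_iso_of_dimVec_eq_single h₁ (hNd.trans h₁) (hh.isSinkReflection hi).isSink
  | step hi hd' H ih =>
    subst hMd
    rcases dimVec_eq_single_or_exists_reflection hh hi M hM with h₁ | ⟨M', ⟨R⟩⟩
    · exact nonempty_iso_of_dimVec_eq_single h₁ (hNd.trans h₁) (hh.isSinkReflection hi).isSink
    · rcases dimVec_eq_single_or_exists_reflection hh hi N hN with h₁ | ⟨N', ⟨R'⟩⟩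
      · exact nonempty_iso_of_dimVec_eq_single (hNd.symm.trans h₁) h₁
          (hh.isSinkReflection hi).isSink
      · obtain ⟨e⟩ := ih (hh.raised hi) M' N' (R.indecomposable hM) (R'.indecomposable hN)
          R.dimVec_eq (by rw [R'.dimVec_eq, hNd])
        exact R.nonempty_iso R' e

/-- Reflect both until one becomes simple at a sink. If it is `M`, it is projective and dim Hom is
the Euler form; if it is `N` alone, Hom is zero. Reflections preserve both dim Hom and the Euler
form. -/
lemma finrank_hom_of_reach {h d : I → ℤ} (H : Reach G h d) (hh : IsHeight G h)
    (M N : QuiverRep K hh.orientation) (hM : Indecomposable M) (hN : Indecomposable N)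
    (hMd : M.dimVec = d) : finrank K (M ⟶ N) = 0 ∨
      (finrank K (M ⟶ N) : ℤ) = eulerForm hh.orientation M.dimVec N.dimVec := by
  induction H with
  | base hi hd' =>
    subst hMd
    have h₁ := dimVec_eq_single_of_not_nonneg hh hi M hM hd'
    have hs := (hh.isSinkReflection hi).isSink
    rw [finrank_hom_of_dimVec_eq_single h₁ hs, h₁, eulerForm_single_left hs]
    exact Or.inr rfl
  | step hi hd' H ih =>
    subst hMd
    have hs := (hh.isSinkReflection hi).isSink
    rcases dimVec_eq_single_or_exists_reflection hh hi M hM with h₁ | ⟨M', ⟨R⟩⟩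
    · rw [finrank_hom_of_dimVec_eq_single h₁ hs, h₁, eulerForm_single_left hs]
      exact Or.inr rfl
    · rcases dimVec_eq_single_or_exists_reflection hh hi N hN with h₁ | ⟨N', ⟨R'⟩⟩
      · exact Or.inl (finrank_hom_to_simple h₁ hs R.surjective)
      · rw [R.finrank_hom_eq R', ← (hh.isSinkReflection hi).eulerForm_simpleReflection,
          ← R.dimVec_eq, ← R'.dimVec_eq]
        exact ih (hh.raised hi) M' N' (R.indecomposable hM) (R'.indecomposable hN) R.dimVec_eq

/-- Here `Reach` runs along the negated height, that is, through reflections at sources, down to a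
simple root. The representation is then built back up by reflecting at the corresponding sinks. -/
lemma exists_of_reach (K : Type u) [Field K] (hG : IsPosDef G) {k d : I → ℤ} (H : Reach G k d)
    (hd : d ∈ positiveRoots G) {h : I → ℤ} (hh : IsHeight G h) (hk : k = -h) :
    ∃ M : QuiverRep K hh.orientation, Indecomposable M ∧ M.dimVec = d := by
  classical
  induction H generalizing h with
  | @base k d i hi hd' =>
    obtain rfl := hG.eq_single hd.1 hd.2 hd'
    obtain ⟨M, hM⟩ := exists_dimVec_eq_single K hh.orientation i
    exact ⟨M, indecomposable_of_dimVec_eq_single hM, hM⟩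
  | @step k d i hi hd' H ih =>
    subst hk
    have hmax (j : I) (hj : G.Adj i j) : h i = h j + 1 := by
      have h₁ : -h i < -h j := hi j hj
      have := hh i j hj
      omega
    have hh₀ : IsHeight G (-raise (-h) i) := by
      have hneg : IsHeight G (-h) := fun j k hjk ↦ by
        have := hh j k hjk
        simp only [Pi.neg_apply]
        omega
      have := hneg.raised hi
      intro j k hjk
      have := this j k hjk
      simp only [Pi.neg_apply]
      omega
    have hraise : raise (-raise (-h) i) i = h := by
      simp [raise]
    have hi₀ : IsLocalMinVertex G (-raise (-h) i) i := fun j hj ↦ by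
      have := hmax j hj
      rw [Pi.neg_apply, Pi.neg_apply, raise_same, raise_of_ne _ hj.ne', Pi.neg_apply, Pi.neg_apply]
      omega
    obtain ⟨M, hM, hMd⟩ := ih ⟨hd', (cartanForm_simpleReflection i d d).trans hd.2⟩ hh₀
      (neg_neg _).symm
    -- The height is generalized because lowering and raising returns `h` only up to a propositional
    -- equality, on which the type of the representation depends.
    have key (h₂ : I → ℤ) (e : raise (-raise (-h) i) i = h₂) (hh₂ : IsHeight G h₂) :
        ∃ N : QuiverRep K hh₂.orientation, Indecomposable N ∧ N.dimVec = d := by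
      subst e
      rcases dimVec_eq_single_or_exists_reflection hh₀ hi₀ M hM with h₁ | ⟨N, ⟨R⟩⟩
      · refine absurd hd.1 ?_
        rw [← simpleReflection_simpleReflection (G := G) i d, ← hMd, h₁]
        exact not_nonneg_simpleReflection_single i
      · exact ⟨N, R.indecomposable hM, by
          rw [R.dimVec_eq, hMd, simpleReflection_simpleReflection]⟩
    exact key h hraise hh

section Gabriel

variable (hG : IsPosDef G)

include hG

lemma dimVec_mem_positiveRoots {M : QuiverRep K Γ} (hM : Indecomposable M) :
    M.dimVec ∈ positiveRoots G := by
  obtain ⟨h, hh, rfl⟩ := exists_height hG.isAcyclic Γ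
  refine ⟨M.dimVec_nonneg, cartanForm_dimVec_of_reach (hG.reach hh M.dimVec_nonneg ?_) hh M hM rfl⟩
  exact fun h₀ ↦ hM.1 ((isZero_iff M).2 h₀)

lemma nonempty_iso_of_dimVec_eq {M N : QuiverRep K Γ} (hM : Indecomposable M)
    (hN : Indecomposable N) (h : M.dimVec = N.dimVec) : Nonempty (M ≅ N) := by
  obtain ⟨h, hh, rfl⟩ := exists_height hG.isAcyclic Γ
  exact nonempty_iso_of_reach (hG.reach hh M.dimVec_nonneg fun h₀ ↦ hM.1 ((isZero_iff M).2 h₀))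
    hh M N hM hN rfl ‹M.dimVec = N.dimVec›.symm

lemma exists_indecomposable (K : Type u) [Field K] (Γ : Orientation G) {d : I → ℤ}
    (hd : d ∈ positiveRoots G) : ∃ M : QuiverRep K Γ, Indecomposable M ∧ M.dimVec = d := by
  obtain ⟨h, hh, rfl⟩ := exists_height hG.isAcyclic Γ
  refine exists_of_reach K hG (hG.reach (h := -h) (fun j k hjk ↦ ?_) hd.1 ?_) hd hh rfl
  · have := hh j k hjk
    simp only [Pi.neg_apply]
    omega
  · rintro rfl
    simpa [cartanForm_eq_sum] using hd.2

/-- The Euler form is dim Hom - dim Ext¹ with at least one of the two terms zero. -/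
lemma extOneVanishes_iff_eulerForm_nonneg {M N : QuiverRep K Γ} (hM : Indecomposable M)
    (hN : Indecomposable N) : ExtOneVanishes M N ↔ 0 ≤ eulerForm Γ M.dimVec N.dimVec := by
  obtain ⟨h₁, h₂⟩ := eulerForm_le_finrank_hom M N
  rw [h₂]
  obtain ⟨h, hh, rfl⟩ := exists_height hG.isAcyclic Γ
  have h₃ := finrank_hom_of_reach (hG.reach hh M.dimVec_nonneg fun h₀ ↦
    hM.1 ((isZero_iff M).2 h₀)) hh M N hM hN rfl
  omega

/-- Passing to dimension vectors identifies Ext-free sets with compatible sets of roots. -/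
lemma encard_extFreeSets (k : ℕ) :
    (extFreeSets K Γ k).encard = (compatibleSets Γ k).encard := by
  let δ : RepClass K Γ → I → ℤ := Quotient.lift dimVec fun _ _ ⟨e⟩ ↦ dimVec_eq_of_iso e
  have hδ : Set.InjOn δ {c | ∀ M : QuiverRep K Γ, ⟦M⟧ = c → Indecomposable M} := by
    intro a ha b hb hab
    induction a using Quotient.inductionOn
    induction b using Quotient.inductionOn
    exact Quotient.sound (nonempty_iso_of_dimVec_eq hG (ha _ rfl) (hb _ rfl) hab)
  have hsub {C : Set (RepClass K Γ)} (hC : C ∈ extFreeSets K Γ k) :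
      C ⊆ {c | ∀ M : QuiverRep K Γ, ⟦M⟧ = c → Indecomposable M} := by
    rintro c hc M rfl
    exact hC.1.1 M hc
  have hind {M N : QuiverRep K Γ} (e : M ≅ N) (hM : Indecomposable M) : Indecomposable N := by
    refine ⟨fun h ↦ hM.1 (h.of_iso e), fun Y Z f ↦ hM.2 Y Z (e ≪≫ f)⟩
  have hinj : Set.InjOn (Set.image δ) (extFreeSets K Γ k) := fun C hC C' hC' h ↦
    (hδ.image_eq_image_iff (hsub hC) (hsub hC')).1 h
  rw [← hinj.encard_image]
  congr 1
  ext S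
  constructor
  · rintro ⟨C, hC, rfl⟩
    refine ⟨?_, ?_, ((hδ.mono (hsub hC)).encard_image).trans hC.2⟩
    · rintro _ ⟨c, hc, rfl⟩
      induction c using Quotient.inductionOn
      exact dimVec_mem_positiveRoots hG (hC.1.1 _ hc)
    · rintro _ ⟨c, hc, rfl⟩ _ ⟨c', hc', rfl⟩
      induction c using Quotient.inductionOn
      induction c' using Quotient.inductionOn
      exact (extOneVanishes_iff_eulerForm_nonneg hG (hC.1.1 _ hc) (hC.1.1 _ hc')).1
        (hC.1.2 _ _ hc hc')
  · rintro ⟨hS, hE, hk⟩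
    let C : Set (RepClass K Γ) :=
      {c | (∀ M : QuiverRep K Γ, ⟦M⟧ = c → Indecomposable M) ∧ δ c ∈ S}
    have hCS : δ '' C = S := by
      refine Set.Subset.antisymm ?_ fun d hd ↦ ?_
      · rintro _ ⟨c, hc, rfl⟩
        exact hc.2
      · obtain ⟨M, hM, rfl⟩ := exists_indecomposable hG K Γ (hS hd)
        refine ⟨⟦M⟧, ⟨fun N hN ↦ ?_, hd⟩, rfl⟩
        obtain ⟨e⟩ := Quotient.exact hN
        exact hind e.symm hM
    refine ⟨C, ⟨⟨fun M hM ↦ hM.1 M rfl, fun M N hM hN ↦ ?_⟩, ?_⟩, hCS⟩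
    · exact (extOneVanishes_iff_eulerForm_nonneg hG (hM.1 M rfl) (hN.1 N rfl)).2
        (hE _ hM.2 _ hN.2)
    · rw [← hk, ← hCS, (hδ.mono fun c hc ↦ hc.1).encard_image]

end Gabriel

end QuiverRep

lemma IsPosDef.exists_encard_extFreeSets_eq (hG : IsPosDef G) (K : Type u) [Field K] (k : ℕ) :
    ∃ f : ℕ, ∀ Γ : Orientation G, (extFreeSets K Γ k).encard = (f : ℕ∞) := by
  by_cases h : Nonempty (Orientation G)
  · obtain ⟨Γ₀⟩ := h
    refine ⟨(compatibleSets Γ₀ k).ncard, fun Γ ↦ ?_⟩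
    rw [QuiverRep.encard_extFreeSets hG, hG.encard_compatibleSets Γ Γ₀,
      (hG.finite_compatibleSets Γ₀ k).cast_ncard_eq]
  · exact ⟨0, fun Γ ↦ absurd ⟨Γ⟩ h⟩

end DynkinQuiver

/-! ### Dynkin graphs are positive definite, through explicit superharmonic functions. -/

namespace DynkinQuiver

universe w

/-- The graph carries a positive strictly superharmonic function. -/
def IsSuperharmonic {I : Type w} [Fintype I] (G : SimpleGraph I) : Prop :=
  ∃ u : I → ℤ, (∀ i, 0 < u i) ∧ ∀ i, neighborSum G i u < 2 * u i

variable {I : Type w} [Fintype I] {G : SimpleGraph I}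

lemma IsSuperharmonic.isPosDef (hG : IsSuperharmonic G) : IsPosDef G := by
  classical
  obtain ⟨u, hu, h⟩ := hG
  refine isPosDef_of_superharmonic (fun i ↦ (u i : ℝ)) (fun i ↦ Int.cast_pos.2 (hu i)) fun i ↦ ?_
  have : ((neighborSum G i u : ℤ) : ℝ) = neighborSum G i fun i ↦ (u i : ℝ) := by
    simp [neighborSum]
  rw [← this]
  exact_mod_cast h i

lemma IsSuperharmonic.of_iso {J : Type*} [Fintype J] {H : SimpleGraph J} (φ : G ≃g H)
    (hH : IsSuperharmonic H) : IsSuperharmonic G := by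
  classical
  obtain ⟨u, hu, h⟩ := hH
  refine ⟨u ∘ φ, fun i ↦ hu _, fun i ↦ ?_⟩
  have : neighborSum G i (u ∘ φ) = neighborSum H (φ i) u :=
    Fintype.sum_equiv φ.toEquiv _ _ fun j ↦ by simp [φ.map_adj_iff]
  rw [this]
  exact h _

lemma IsSuperharmonic.of_connectedComponent
    (h : ∀ c : G.ConnectedComponent, ∀ _ : Fintype c, IsSuperharmonic c.toSimpleGraph) :
    IsSuperharmonic G := by
  classical
  choose U hU₀ hU using fun c : G.ConnectedComponent ↦ h c inferInstance
  let u (i : I) : ℤ := U (G.connectedComponentMk i) ⟨i, rfl⟩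
  have hu (c : G.ConnectedComponent) (j : c) : U c j = u j := by
    obtain ⟨j, rfl⟩ := j
    rfl
  refine ⟨u, fun i ↦ hU₀ _ _, fun i ↦ ?_⟩
  have := hU (G.connectedComponentMk i) ⟨i, rfl⟩
  rw [hu] at this
  refine lt_of_eq_of_lt ?_ this
  rw [neighborSum, neighborSum]
  simp only [hu]
  have key : ∑ j, (if G.Adj i j then u j else 0) =
      ∑ j ∈ Finset.univ.filter (· ∈ G.connectedComponentMk i), if G.Adj i j then u j else 0 := by
    refine (Finset.sum_subset (Finset.subset_univ _) fun j _ hj ↦ if_neg fun hij ↦ hj ?_).symm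
    rw [Finset.mem_filter]
    exact ⟨Finset.mem_univ _,
      (SimpleGraph.ConnectedComponent.connectedComponentMk_eq_of_adj hij).symm⟩
  rw [key, Finset.sum_subtype (F := Subtype.fintype _) (Finset.univ.filter (· ∈ G.connectedComponentMk i))
    (p := (· ∈ G.connectedComponentMk i)) (by simp)]
  refine Finset.sum_congr (by ext; simp) fun j _ ↦ ?_
  rfl

section Types

lemma neighborSum_cartanGraph {n : ℕ} (C : Matrix (Fin n) (Fin n) ℤ) (i : Fin n) (u : Fin n → ℤ) :
    neighborSum (cartanGraph C) i u =
      ∑ j, if i ≠ j ∧ (C i j ≠ 0 ∨ C j i ≠ 0) then u j else 0 := by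
  refine Finset.sum_congr rfl fun j _ ↦ ?_
  simp only [cartanGraph, SimpleGraph.fromRel_adj]

/-- Superharmonicity needs only an upper bound, so it suffices to list possible neighbors as natural
numbers, some of which need not be vertices. -/
lemma neighborSum_cartanGraph_le {n : ℕ} (C : Matrix (Fin n) (Fin n) ℤ) (i : Fin n) (f : ℕ → ℤ)
    (T : Finset ℕ) (hf : ∀ m ∈ T, 0 ≤ f m)
    (hT : ∀ j : Fin n, i ≠ j → (C i j ≠ 0 ∨ C j i ≠ 0) → (j : ℕ) ∈ T) :
    neighborSum (cartanGraph C) i (fun j ↦ f j) ≤ ∑ m ∈ T, f m := by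
  rw [neighborSum_cartanGraph, ← Finset.sum_filter]
  refine (Finset.sum_map _ ⟨Fin.val, Fin.val_injective⟩ f).symm.trans_le ?_
  refine Finset.sum_le_sum_of_subset_of_nonneg (fun m hm ↦ ?_) fun m hm _ ↦ hf m hm
  obtain ⟨j, hj, rfl⟩ := Finset.mem_map.1 hm
  rw [Finset.mem_filter] at hj
  exact hT j hj.2.1 hj.2.2

lemma isSuperharmonic_A (n : ℕ) : IsSuperharmonic (cartanGraph (CartanMatrix.A n)) := by
  -- The coefficients of the sum of all positive roots: twice each value exceeds the neighbor sum by
  -- 2, as `f` is quadratic and vanishes at both ends, -1 and `n`.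
  let f (m : ℕ) : ℤ := (m + 1) * (n - m)
  have hf (m : ℕ) (hm : m ≤ n) : 0 ≤ f m :=
    mul_nonneg (by positivity) (sub_nonneg.2 (by exact_mod_cast hm))
  have hadj (i j : Fin n) (hij : i ≠ j)
      (h : CartanMatrix.A n i j ≠ 0 ∨ CartanMatrix.A n j i ≠ 0) :
      (j : ℕ) = i + 1 ∨ (j : ℕ) + 1 = i := by
    simp only [CartanMatrix.A, Matrix.of_apply, hij, hij.symm, if_false] at h
    split_ifs at h <;> omega
  refine ⟨fun i ↦ f i, fun i ↦ mul_pos (by positivity) (sub_pos.2 (by exact_mod_cast i.2)),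
    fun i ↦ ?_⟩
  have hi := i.2
  rcases hi' : (i : ℕ) with _ | m
  · refine (neighborSum_cartanGraph_le _ i f {1} (by simpa using hf 1 (by omega))
      fun j h₁ h₂ ↦ ?_).trans_lt ?_
    · have := hadj i j h₁ h₂
      rw [Finset.mem_singleton]
      omega
    · dsimp only
      rw [Finset.sum_singleton, hi']
      simp only [f]
      push_cast
      linarith
  -- At the last vertex `m + 2` equals `n`, which is not a vertex, but `f n = 0`.
  · refine (neighborSum_cartanGraph_le _ i f {m, m + 2} (fun k hk ↦ hf k ?_)
      fun j h₁ h₂ ↦ ?_).trans_lt ?_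
    · rw [Finset.mem_insert, Finset.mem_singleton] at hk
      omega
    · have := hadj i j h₁ h₂
      rw [Finset.mem_insert, Finset.mem_singleton]
      omega
    · dsimp only
      rw [Finset.sum_pair (by omega), hi']
      simp only [f]
      push_cast
      linarith

lemma isSuperharmonic_D (n : ℕ) (hn : 4 ≤ n) :
    IsSuperharmonic (cartanGraph (CartanMatrix.D n)) := by
  obtain ⟨N, rfl⟩ := Nat.exists_eq_add_of_le' hn
  -- Twice the coefficients of the sum of positive roots, so every excess is 4. On the two fork
  -- vertices the value is half of what the quadratic formula gives at `N + 2`.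
  let f (m : ℕ) : ℤ := if m < N + 2 then 2 * (m + 1) * (2 * N + 6 - m) else (N + 4) * (N + 3)
  have hf₁ (m : ℕ) (hm : m < N + 2) : f m = 2 * (m + 1) * (2 * N + 6 - m) := if_pos hm
  have hf₂ (m : ℕ) (hm : ¬ m < N + 2) : f m = (N + 4) * (N + 3) := if_neg hm
  have hf (m : ℕ) : 0 < f m := by
    by_cases hm : m < N + 2
    · rw [hf₁ m hm]
      have : (m : ℤ) < N + 2 := by exact_mod_cast hm
      exact mul_pos (by positivity) (by linarith)
    · rw [hf₂ m hm]
      positivity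
  have hadj (i j : Fin (N + 4)) (hij : i ≠ j)
      (h : CartanMatrix.D (N + 4) i j ≠ 0 ∨ CartanMatrix.D (N + 4) j i ≠ 0) :
      ((i : ℕ) + 1 = j ∧ (j : ℕ) < N + 2) ∨ ((j : ℕ) + 1 = i ∧ (i : ℕ) < N + 2) ∨
      ((i : ℕ) = N + 1 ∧ N + 2 ≤ (j : ℕ)) ∨ ((j : ℕ) = N + 1 ∧ N + 2 ≤ (i : ℕ)) := by
    simp only [CartanMatrix.D, Matrix.of_apply, hij, hij.symm, if_false] at h
    split_ifs at h <;> omega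
  refine ⟨fun i ↦ f i, fun i ↦ hf i, fun i ↦ ?_⟩
  have key (T : Finset ℕ) (hT : ∀ j : Fin (N + 4), i ≠ j → (CartanMatrix.D (N + 4) i j ≠ 0 ∨
      CartanMatrix.D (N + 4) j i ≠ 0) → (j : ℕ) ∈ T) (h : ∑ m ∈ T, f m < 2 * f i) :
      neighborSum (cartanGraph (CartanMatrix.D (N + 4))) i (fun j ↦ f j) < 2 * f i :=
    (neighborSum_cartanGraph_le _ i f T (fun m _ ↦ (hf m).le) hT).trans_lt h
  have hi := i.2
  by_cases h₁ : N + 2 ≤ (i : ℕ)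
  · refine key {N + 1} (fun j hij h ↦ ?_) ?_
    · have := hadj i j hij h
      rw [Finset.mem_singleton]
      omega
    · rw [Finset.sum_singleton, hf₁ _ (by omega), hf₂ _ (by omega)]
      push_cast
      linarith
  · by_cases h₂ : (i : ℕ) = N + 1
    · refine key {N, N + 2, N + 3} (fun j hij h ↦ ?_) ?_
      · have := hadj i j hij h
        have := j.2
        rw [Finset.mem_insert, Finset.mem_insert, Finset.mem_singleton]
        omega
      · rw [Finset.sum_insert (by simp), Finset.sum_pair (by omega), hf₁ _ (by omega),
          hf₂ _ (by omega), hf₂ _ (by omega), hf₁ _ (by omega), h₂]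
        push_cast
        linarith
    · rcases hi' : (i : ℕ) with _ | m
      · refine key {1} (fun j hij h ↦ ?_) ?_
        · have := hadj i j hij h
          rw [Finset.mem_singleton]
          omega
        · rw [Finset.sum_singleton, hf₁ _ (by omega), hf₁ _ (by omega), hi']
          push_cast
          linarith
      · refine key {m, m + 2} (fun j hij h ↦ ?_) ?_
        · have := hadj i j hij h
          rw [Finset.mem_insert, Finset.mem_singleton]
          omega
        · rw [Finset.sum_pair (by omega), hf₁ _ (by omega), hf₁ _ (by omega), hf₁ _ (by omega), hi']
          push_cast
          linarith

lemma isSuperharmonic_E₆ : IsSuperharmonic (cartanGraph CartanMatrix.E₆) := by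
  -- As for the other two exceptional types, the coefficients of the sum of all positive roots;
  -- every excess is 2.
  refine ⟨![16, 22, 30, 42, 30, 16], by decide, fun i ↦ ?_⟩
  rw [neighborSum_cartanGraph]
  revert i
  decide

lemma isSuperharmonic_E₇ : IsSuperharmonic (cartanGraph CartanMatrix.E₇) := by
  refine ⟨![34, 49, 66, 96, 75, 52, 27], by decide, fun i ↦ ?_⟩
  rw [neighborSum_cartanGraph]
  revert i
  decide

lemma isSuperharmonic_E₈ : IsSuperharmonic (cartanGraph CartanMatrix.E₈) := by
  refine ⟨![92, 136, 182, 270, 220, 168, 114, 58], by decide, fun i ↦ ?_⟩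
  rw [neighborSum_cartanGraph]
  revert i
  decide

lemma IsConnectedDynkin.isSuperharmonic (hG : IsConnectedDynkin G) : IsSuperharmonic G := by
  rcases hG with ⟨n, -, ⟨φ⟩⟩ | ⟨n, hn, ⟨φ⟩⟩ | ⟨⟨φ⟩⟩ | ⟨⟨φ⟩⟩ | ⟨⟨φ⟩⟩
  · exact (isSuperharmonic_A n).of_iso φ
  · exact (isSuperharmonic_D n hn).of_iso φ
  · exact isSuperharmonic_E₆.of_iso φ
  · exact isSuperharmonic_E₇.of_iso φ
  · exact isSuperharmonic_E₈.of_iso φ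

end Types

lemma IsDynkin.isPosDef (hG : IsDynkin G) : IsPosDef G :=
  (IsSuperharmonic.of_connectedComponent fun c _ ↦ (hG c).isSuperharmonic).isPosDef

end DynkinQuiver

theorem proposition6p1 {K : Type*} [Field K] [IsAlgClosed K] {I : Type*} [Finite I]
    (G : SimpleGraph I) (hG : DynkinQuiver.IsDynkin G) (k : ℕ) :
    ∃ f : ℕ, ∀ Γ : DynkinQuiver.Orientation G,
      (DynkinQuiver.extFreeSets K Γ k).encard = (f : ℕ∞) :=
  have := Fintype.ofFinite I
  hG.isPosDef.exists_encard_extFreeSets_eq K k
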